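/- Let $N\ge 1$. For suitable $u,w:\mathbb R^N\to\mathbb C$ put $\hat u(y)=\mathcal F[u](y)=(2\pi)^{-N}\int u(x)e^{-\mathrm i x\cdot y}\,dx$ and $\mathcal F^{-1}[w](x)=\int w(y)e^{\mathrm i x\cdot y}\,dy$. For $m\in\mathbb N$ let $S^m_{1,0}$ be the set of $F\in C^\infty(\mathbb R^N\times\mathbb R^N;\mathbb C)$ such that for every compact $\Omega\subset\mathbb R^N$ and all multi-indices $\alpha,\beta$ there is $C>0$ with $|D_x^\beta D_y^\alpha F(x,y)|\le C(1+|y|)^{m-|\alpha|}$ for all $x\in\Omega$, $y\in\mathbb R^N$. A *symbol* is an element of $\bigcup_{m\in\mathbb N}S^m_{1,0}$. For a symbol $F$ put $$F(x,D)u(x)=\int F(x,y)\hat u(y)e^{\mathrm i x\cdot y}\,dy\quad(u\in\mathcal S(\mathbb R^N)),\qquad F(D,x)=\mathcal F\circ F(x,D)^\dagger\circ\mathcal F^{-1},$$ where $F(x,D)^\dagger$ is the formal adjoint, acting on $C_c^\infty(\mathbb R^N)$; thus $F(D,x)$ is defined on the functions $f\in\mathcal S(\mathbb R^N)$ with $\mathcal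 F^{-1}f\in C_c^\infty(\mathbb R^N)$, which are dense in $L_2(\mathbb R^N)$. Let $\|T\|_{\rm HS}\in[0,\infty]$ be the Hilbert–Schmidt norm on $L_2(\mathbb R^N)$ of an operator $T$ with this dense domain, i.e. the supremum of $(\sum_i\|Tf_i\|_{L_2}^2)^{1/2}$ over finite $L_2$-orthonormal families $(f_i)$ in the domain. Also let ${\rm O}_Fu(x)=\int F(x,y)u(y)\,dy$, and let $\mathcal R[{\rm O}_F^\dagger]$ be the range of ${\rm O}_F^\dagger u(y)=\int\overline{F(x,y)}u(x)\,dx$, $u\in C_c^\infty(\mathbb R^N)$. Fix a normalising constant $\kappa>0$. For $K:\mathbb R^N\times\mathbb R^N\to\mathbb R$ (for instance a Mercer kernel) and a symbol $F$ write $K=K^F$ if $F(x,D)u\in L_2$ for all $u\in\mathcal S(\mathbb R^N)$ and, for all $u,v\in\mathcal S(\mathbb R^N)$, $$\langle F(x,D)u,F(x,D)v\rangle_{L_2}=\kappa\int_{\mathbb R^N\times\mathbb R^N}\overline{\hat u(x)}\,K(x,y)\,\hat v(y)\,dx\,dy,$$ where the integral on the right converges absolutely. Define the approximation error of $K$ at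 rank $r$ by $$d^0_K(r)=\inf\bigl\{\|F(D,x)-G(D,x)\|_{\rm HS}:\ F,G\text{ symbols},\ K^F=K,\ \dim\mathcal R[{\rm O}_G^\dagger]=r\bigr\}\in[0,\infty].$$ **Proposition.** There is a constant $c\ge0$, depending only on $N$, such that the following holds for every $\kappa>0$. Let $F$ be a symbol with $\dim\mathcal R[{\rm O}_F^\dagger]=d<\infty$, let $\delta F$ be a Hilbert–Schmidt kernel (i.e. $\delta F\in L_2(\mathbb R^N\times\mathbb R^N)$) such that $K=K^{F+\delta F}$ (in particular $F+\delta F$ is a symbol), and let $\sigma_1\ge\sigma_2\ge\cdots$ be the singular values of ${\rm O}_{\delta F}:L_2(\mathbb R^N)\to L_2(\mathbb R^N)$, counted with multiplicity and continued by zeros if ${\rm O}_{\delta F}$ has finite rank. Then for every $n\ge d$ $$d^0_K(n)\le c\,\Bigl(\sum_{i=n-d+1}^\infty\sigma_i^2\Bigr)^{1/2}.$$ -/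

import Mathlib

open MeasureTheory
open scoped ENNReal NNReal SchwartzMap ContDiff ComplexConjugate InnerProductSpace

noncomputable section

/-! ## Integral operators with square-integrable kernels -/

section IntegralOperator

variable {α : Type*} [MeasurableSpace α] {μ : Measure α}

/-- The integral operator `O_H u (x) = ∫ H(x, y) u(y) dy`, on functions. -/
def intOp (μ : Measure α) (H : α → α → ℂ) (u : α → ℂ) (x : α) : ℂ := ∫ y, H x y * u y ∂μ

theorem lintegral_mul_sq_le (f g : α → ℝ≥0∞) (hf : AEMeasurable f μ) (hg : AEMeasurable g μ) :
    (∫⁻ y, f y * g y ∂μ) ^ 2 ≤ (∫⁻ y, f y ^ 2 ∂μ) * (∫⁻ y, g y ^ 2 ∂μ) := by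
  have h := ENNReal.lintegral_mul_le_Lp_mul_Lq μ (Real.HolderConjugate.two_two) hf hg
  have h2 := pow_le_pow_left' h 2
  simp only [Pi.mul_apply] at h2
  refine h2.trans (le_of_eq ?_)
  rw [mul_pow]
  have e : ∀ a : ℝ≥0∞, (a ^ (1 / (2 : ℝ))) ^ 2 = a := by
    intro a
    rw [← ENNReal.rpow_natCast, ← ENNReal.rpow_mul]; norm_num
  rw [e, e]
  norm_num

theorem sq_eLpNorm_two (f : α → ℂ) : eLpNorm f 2 μ ^ 2 = ∫⁻ x, ‖f x‖ₑ ^ 2 ∂μ := by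
  rw [eLpNorm_eq_lintegral_rpow_enorm_toReal (by norm_num) (by norm_num), ← ENNReal.rpow_natCast,
    ← ENNReal.rpow_mul]
  norm_num

variable [SFinite μ] {H : α → α → ℂ}

theorem intOp_ae_integrable (hH : MemLp (Function.uncurry H) 2 (μ.prod μ)) {u : α → ℂ}
    (hu : MemLp u 2 μ) : ∀ᵐ x ∂μ, Integrable (fun y => H x y * u y) μ := by
  have h1 : ∀ᵐ x ∂μ, AEStronglyMeasurable (fun y => H x y) μ := hH.1.prodMk_left
  have h2 : ∫⁻ x, ∫⁻ y, ‖H x y‖ₑ ^ 2 ∂μ ∂μ < ⊤ := by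
    have := sq_eLpNorm_two (μ := μ.prod μ) (Function.uncurry H)
    rw [lintegral_prod _ (hH.1.enorm.pow_const 2)] at this
    have h3 : eLpNorm (Function.uncurry H) 2 (μ.prod μ) ^ 2 < ⊤ := ENNReal.pow_lt_top hH.2
    rw [this] at h3
    exact h3
  have h3 : ∀ᵐ x ∂μ, ∫⁻ y, ‖H x y‖ₑ ^ 2 ∂μ < ⊤ :=
    ae_lt_top' ((hH.1.enorm.pow_const 2).lintegral_prod_right') h2.ne
  filter_upwards [h1, h3] with x hx1 hx3
  have hm : MemLp (fun y => H x y) 2 μ := by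
    refine ⟨hx1, ?_⟩
    rw [← sq_eLpNorm_two] at hx3
    by_contra hcon
    rw [not_lt, top_le_iff] at hcon
    rw [hcon] at hx3
    simp at hx3
  exact hm.integrable_mul hu

theorem lintegral_intOp_sq_le (hH : MemLp (Function.uncurry H) 2 (μ.prod μ)) {u : α → ℂ}
    (hu : MemLp u 2 μ) :
    eLpNorm (intOp μ H u) 2 μ ≤ eLpNorm (Function.uncurry H) 2 (μ.prod μ) * eLpNorm u 2 μ := by
  have h1 : ∀ᵐ x ∂μ, AEStronglyMeasurable (fun y => H x y) μ := hH.1.prodMk_left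
  rw [← ENNReal.pow_le_pow_left_iff two_ne_zero, mul_pow, sq_eLpNorm_two, sq_eLpNorm_two,
    sq_eLpNorm_two, lintegral_prod _ (hH.1.enorm.pow_const 2),
    ← lintegral_mul_const'' _ ((hH.1.enorm.pow_const 2).lintegral_prod_right')]
  refine lintegral_mono_ae ?_
  filter_upwards [h1] with x hx
  refine le_trans (pow_le_pow_left' (enorm_integral_le_lintegral_enorm _) 2) ?_
  simp only [enorm_mul]
  exact lintegral_mul_sq_le _ _ hx.enorm hu.1.enorm

theorem intOp_memLp (hH : MemLp (Function.uncurry H) 2 (μ.prod μ)) {u : α → ℂ}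
    (hu : MemLp u 2 μ) : MemLp (intOp μ H u) 2 μ := by
  refine ⟨?_, (lintegral_intOp_sq_le hH hu).trans_lt (ENNReal.mul_lt_top hH.2 hu.2)⟩
  exact (hH.1.mul hu.1.comp_snd).integral_prod_right'

/-- A kernel `H ∈ L²(α × α)` is a Hilbert–Schmidt kernel; this is the bounded operator
`O_H : L² → L²`, `O_H u (x) = ∫ H(x, y) u(y) dy`. -/
def intOpL2 (H : α → α → ℂ) (hH : MemLp (Function.uncurry H) 2 (μ.prod μ)) :
    Lp ℂ 2 μ →L[ℂ] Lp ℂ 2 μ :=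
  LinearMap.mkContinuous
    { toFun := fun u => (intOp_memLp hH (Lp.memLp u)).toLp
      map_add' := by
        intro u v
        rw [← MemLp.toLp_add]
        refine MemLp.toLp_congr _ _ ?_
        filter_upwards [intOp_ae_integrable hH (Lp.memLp u), intOp_ae_integrable hH (Lp.memLp v)]
          with x h1 h2
        simp only [intOp, Pi.add_apply]
        rw [← integral_add h1 h2]
        refine integral_congr_ae ?_
        filter_upwards [Lp.coeFn_add u v] with y hy
        rw [hy, Pi.add_apply, mul_add]
      map_smul' := by
        intro c u
        rw [RingHom.id_apply, ← MemLp.toLp_const_smul]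
        refine MemLp.toLp_congr _ _ ?_
        filter_upwards with x
        simp only [intOp, Pi.smul_apply, smul_eq_mul]
        rw [← integral_const_mul]
        refine integral_congr_ae ?_
        filter_upwards [Lp.coeFn_smul c u] with y hy
        rw [hy, Pi.smul_apply, smul_eq_mul]
        ring }
    (eLpNorm (Function.uncurry H) 2 (μ.prod μ)).toReal
    (by
      intro u
      simp only [LinearMap.coe_mk, AddHom.coe_mk, Lp.norm_toLp]
      rw [Lp.norm_def, ← ENNReal.toReal_mul]
      exact ENNReal.toReal_mono (ENNReal.mul_lt_top hH.2 (Lp.memLp u).2).ne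
        (lintegral_intOp_sq_le hH (Lp.memLp u)))

theorem intOpL2_coeFn (hH : MemLp (Function.uncurry H) 2 (μ.prod μ)) (u : Lp ℂ 2 μ) :
    intOpL2 H hH u =ᵐ[μ] intOp μ H u :=
  (intOp_memLp hH (Lp.memLp u)).coeFn_toLp

end IntegralOperator

/-- `σ 0 ≥ σ 1 ≥ …` is the sequence of singular values of the (compact) operator `T`: every `s > 0`
occurs in it as often as the multiplicity of `s ^ 2` as an eigenvalue of `T† T` (so the sequence
ends with zeros if `T` has finite rank). -/
structure IsSingularValueSeq {E : Type*} [NormedAddCommGroup E] [InnerProductSpace ℂ E]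
    [CompleteSpace E] (T : E →L[ℂ] E) (σ : ℕ → ℝ) : Prop where
  nonneg : ∀ i, 0 ≤ σ i
  antitone : Antitone σ
  multiplicity : ∀ s : ℝ, 0 < s → {i | σ i = s}.encard =
    Cardinal.toENat (Module.rank ℂ
      (Module.End.eigenspace (T.adjoint ∘L T).toLinearMap ((s : ℂ) ^ 2)))

/-! ## Pseudo-differential operators -/

/-- `ℝ^N` with the Euclidean norm and Lebesgue measure. -/
abbrev RN (N : ℕ) := EuclideanSpace ℝ (Fin N)

variable {N : ℕ}

/-- The symbol class `S^m_{1,0}`: smooth functions on `ℝ^N × ℝ^N` with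
`|D_x^β D_y^α F(x, y)| ≤ C (1 + |y|)^(m - |α|)` for `x` in a compact set `Ω`, where
`C = C(Ω, α, β)`. The total derivatives of order `a = |α|` and `b = |β|` collect the partial ones. -/
def SymbolClass (m : ℝ) (F : RN N → RN N → ℂ) : Prop :=
  ContDiff ℝ ∞ (Function.uncurry F) ∧
  ∀ Ω : Set (RN N), IsCompact Ω → ∀ a b : ℕ, ∃ C : ℝ, 0 < C ∧ ∀ x ∈ Ω, ∀ y : RN N,
    ‖iteratedFDeriv ℝ b (fun x' => iteratedFDeriv ℝ a (fun y' => F x' y') y) x‖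
      ≤ C * (1 + ‖y‖) ^ (m - a)

/-- `F` is a symbol: it is in `S^m_{1,0}` for some `m ∈ ℕ`. -/
def IsSymbol (F : RN N → RN N → ℂ) : Prop := ∃ m : ℕ, SymbolClass (m : ℝ) F

/-- The Fourier transform `û(y) = (2π)^(-N) ∫ u(x) e^(-i x·y) dx`. -/
def fourierHat (u : RN N → ℂ) (y : RN N) : ℂ :=
  ((2 * Real.pi : ℝ) : ℂ) ^ (-(N : ℤ)) * ∫ x, u x * Complex.exp (-(Complex.I * ⟪x, y⟫_ℝ))

/-- The inverse Fourier transform `(𝓕⁻¹ w)(x) = ∫ w(y) e^(i x·y) dy`. -/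
def fourierCheck (w : RN N → ℂ) (x : RN N) : ℂ :=
  ∫ y, w y * Complex.exp (Complex.I * ⟪x, y⟫_ℝ)

/-- The operator `F(x, D) u (x) = ∫ F(x, y) û(y) e^(i x·y) dy`. -/
def pdo (F : RN N → RN N → ℂ) (u : RN N → ℂ) (x : RN N) : ℂ :=
  ∫ y, F x y * fourierHat u y * Complex.exp (Complex.I * ⟪x, y⟫_ℝ)

/-- The operator `F(D, x) = 𝓕 ∘ F(x, D)† ∘ 𝓕⁻¹`. As `F(x, D)` is `𝓕` followed by the operator with
the kernel `F(x, y) e^(i x·y)`, and `𝓕 𝓕† = (2π)^(-N)`, this is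
`F(D, x) f (y) = (2π)^(-N) ∫ conj (F(x, y)) e^(-i x·y) (𝓕⁻¹ f)(x) dx`, see `pdo_adjoint`.
The integral converges absolutely if `𝓕⁻¹ f` is a test function, for every symbol `F`. -/
def pdoRight (F : RN N → RN N → ℂ) (f : RN N → ℂ) (y : RN N) : ℂ :=
  ((2 * Real.pi : ℝ) : ℂ) ^ (-(N : ℤ)) *
    ∫ x, conj (F x y) * Complex.exp (-(Complex.I * ⟪x, y⟫_ℝ)) * fourierCheck f x

theorem fourierHat_eq (u : 𝓢(RN N, ℂ)) (y : RN N) :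
    fourierHat u y = ((2 * Real.pi : ℝ) : ℂ) ^ (-(N : ℤ)) *
      (FourierTransform.fourier u : 𝓢(RN N, ℂ)) ((2 * Real.pi)⁻¹ • y) := by
  rw [fourierHat, SchwartzMap.fourier_coe, Real.fourier_eq']
  congr 1
  refine integral_congr_ae (Filter.Eventually.of_forall fun x => ?_)
  have hpi : (Real.pi : ℂ) ≠ 0 := by exact_mod_cast Real.pi_ne_zero
  simp only [inner_smul_right, smul_eq_mul]
  rw [mul_comm]
  congr 2
  push_cast
  field_simp

theorem fourierCheck_eq (w : 𝓢(RN N, ℂ)) (x : RN N) :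
    fourierCheck w x = (FourierTransformInv.fourierInv w : 𝓢(RN N, ℂ)) ((2 * Real.pi)⁻¹ • x) := by
  rw [fourierCheck, SchwartzMap.fourierInv_coe, Real.fourierInv_eq']
  refine integral_congr_ae (Filter.Eventually.of_forall fun y => ?_)
  have hpi : (Real.pi : ℂ) ≠ 0 := by exact_mod_cast Real.pi_ne_zero
  simp only [inner_smul_right, smul_eq_mul]
  rw [mul_comm, real_inner_comm]
  congr 2
  push_cast
  field_simp

theorem continuous_fourierHat (u : 𝓢(RN N, ℂ)) : Continuous (fourierHat u) := by
  rw [funext (fourierHat_eq u)]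
  exact continuous_const.mul ((SchwartzMap.continuous _).comp (continuous_const_smul _))

theorem continuous_fourierCheck (u : 𝓢(RN N, ℂ)) : Continuous (fourierCheck u) := by
  rw [funext (fourierCheck_eq u)]
  exact (SchwartzMap.continuous _).comp (continuous_const_smul _)

theorem integrable_pow_mul_fourierHat (u : 𝓢(RN N, ℂ)) (m : ℕ) :
    Integrable (fun y => (1 + ‖y‖) ^ m * ‖fourierHat u y‖) := by
  have h : ∀ k : ℕ, Integrable (fun y : RN N => ‖y‖ ^ k * ‖fourierHat u y‖) := by
    intro k
    have h1 := SchwartzMap.integrable_pow_mul volume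
      (FourierTransform.fourier u : 𝓢(RN N, ℂ)) k
    have h2 := (h1.comp_smul (R := (2 * Real.pi)⁻¹) (by positivity)).const_mul
      ((2 * Real.pi) ^ k * ‖((2 * Real.pi : ℝ) : ℂ) ^ (-(N : ℤ))‖)
    refine h2.congr (Filter.Eventually.of_forall fun y => ?_)
    simp only [fourierHat_eq, norm_mul, norm_smul, mul_pow, norm_inv, Real.norm_eq_abs, inv_pow,
      abs_of_pos Real.pi_pos, abs_two]
    have := Real.pi_pos
    field_simp
  simp only [add_comm (1 : ℝ), add_pow, Finset.sum_mul]
  refine integrable_finsetSum _ fun k _ => ?_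
  refine ((h k).mul_const ((m.choose k : ℝ))).congr (Filter.Eventually.of_forall fun y => ?_)
  simp only [one_pow]
  ring

/-- `⟨F(x, D) u, 𝓕⁻¹ f⟩ = ⟨u, 𝓕⁻¹ F(D, x) f⟩` (here `𝓕⁻¹ = (2π)^N 𝓕†`), so `F(D, x)` is the
operator `𝓕 ∘ F(x, D)† ∘ 𝓕⁻¹`. -/
theorem pdo_adjoint {F : RN N → RN N → ℂ} (hF : IsSymbol F) (u f : 𝓢(RN N, ℂ))
    (hf : HasCompactSupport (fourierCheck f)) :
    ∫ x, conj (pdo F u x) * fourierCheck f x =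
      ((2 * Real.pi : ℝ) : ℂ) ^ N * ∫ y, conj (fourierHat u y) * pdoRight F f y := by
  obtain ⟨m, hc, hb⟩ := hF
  have hcF : Continuous (fun p : RN N × RN N => F p.1 p.2) := hc.continuous
  obtain ⟨C, hC, hbd⟩ := hb _ hf.isCompact 0 0
  set φ := fourierCheck f with hφ
  have hφc : Continuous φ := continuous_fourierCheck f
  let k : RN N → RN N → ℂ := fun x y =>
    conj (F x y * fourierHat u y * Complex.exp (Complex.I * ⟪x, y⟫_ℝ)) * φ x
  have hnorm : ∀ x y : RN N, ‖Complex.exp (Complex.I * ⟪x, y⟫_ℝ)‖ = 1 := by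
    intro x y
    rw [mul_comm, Complex.norm_exp_ofReal_mul_I]
  have hint : Integrable (Function.uncurry k) (volume.prod volume) := by
    have h1 : Integrable (fun x => C * ‖φ x‖) :=
      ((hφc.integrable_of_hasCompactSupport hf).norm).const_mul C
    refine (h1.mul_prod (integrable_pow_mul_fourierHat u m)).mono' ?_ ?_
    · refine Continuous.aestronglyMeasurable ?_
      have := (continuous_fourierHat u).comp (continuous_snd (X := RN N))
      have h3 := hφc.comp (continuous_fst (Y := RN N))
      simp only [Function.comp_def] at this h3
      simp only [Function.uncurry_def, k]
      fun_prop
    · refine Filter.Eventually.of_forall fun p => ?_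
      simp only [Function.uncurry_def, k, norm_mul, RCLike.norm_conj, hnorm, mul_one]
      by_cases hx : p.1 ∈ tsupport φ
      · have h4 := hbd p.1 hx p.2
        simp only [norm_iteratedFDeriv_zero, Nat.cast_zero, sub_zero, Real.rpow_natCast] at h4
        calc ‖F p.1 p.2‖ * ‖fourierHat u p.2‖ * ‖φ p.1‖
            ≤ (C * (1 + ‖p.2‖) ^ m) * ‖fourierHat u p.2‖ * ‖φ p.1‖ := by gcongr
          _ = _ := by ring
      · rw [image_eq_zero_of_notMem_tsupport hx]
        simp
  have hL : ∀ x, conj (pdo F u x) * φ x = ∫ y, k x y := by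
    intro x
    rw [pdo, ← integral_conj, ← integral_mul_const]
  have hR : ∀ y, ((2 * Real.pi : ℝ) : ℂ) ^ N * (conj (fourierHat u y) * pdoRight F f y) =
      ∫ x, k x y := by
    intro y
    have hpi : ((2 * Real.pi : ℝ) : ℂ) ≠ 0 := by exact_mod_cast Real.two_pi_pos.ne'
    have h5 : ((2 * Real.pi : ℝ) : ℂ) ^ N * (conj (fourierHat u y) * pdoRight F f y) =
        conj (fourierHat u y) *
          ∫ x, conj (F x y) * Complex.exp (-(Complex.I * ⟪x, y⟫_ℝ)) * φ x := by
      rw [pdoRight, zpow_neg, zpow_natCast, hφ]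
      field_simp
    rw [h5, ← integral_const_mul]
    refine integral_congr_ae (Filter.Eventually.of_forall fun x => ?_)
    simp only [k, map_mul, ← Complex.exp_conj, Complex.conj_I, Complex.conj_ofReal, neg_mul]
    ring
  rw [← integral_const_mul]
  simp only [hL, hR]
  exact integral_integral_swap hint

/-- The range of `O_G† u (y) = ∫ conj (G(x, y)) u(x) dx`, where `u` runs over the test functions
`C_c^∞(ℝ^N)`. -/
def rangeAdjoint (G : RN N → RN N → ℂ) : Submodule ℂ (RN N → ℂ) :=
  Submodule.span ℂ {g | ∃ u : 𝓢(RN N, ℂ), HasCompactSupport u ∧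
    g = intOp volume (fun y x => conj (G x y)) u}

/-- The Hilbert–Schmidt norm `(sup ∑ ‖T f_i‖²)^(1/2) ∈ [0, ∞]` of an operator `T` on
functions on `ℝ^N` with the domain `{f ∈ 𝓢 : 𝓕⁻¹ f ∈ C_c^∞}`, dense in `L²`, where the supremum is
over the finite orthonormal families in this domain. -/
def hsNorm (T : (RN N → ℂ) → RN N → ℂ) : ℝ≥0∞ :=
  (⨆ (k : ℕ) (f : Fin k → 𝓢(RN N, ℂ)) (_ : ∀ i, HasCompactSupport (fourierCheck (f i)))
    (_ : ∀ i j, ∫ x, conj (f i x) * f j x = if i = j then 1 else 0),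
      ∑ i, ∫⁻ x, ‖T (f i) x‖ₑ ^ 2) ^ (1 / 2 : ℝ)

/-- `F ∈ Sym(K)`, that is, `K = K^F`: `F` is a symbol and
`⟨F(x, D) u, F(x, D) v⟩ = κ ∫∫ conj (û(x)) K(x, y) v̂(y) dx dy` for all Schwartz functions `u, v`,
with both sides defined. Here `κ > 0` is the normalising constant that is fixed for all kernels. -/
def MemSym (κ : ℝ) (K : RN N → RN N → ℝ) (F : RN N → RN N → ℂ) : Prop :=
  IsSymbol F ∧ (∀ u : 𝓢(RN N, ℂ), MemLp (pdo F u) 2 volume) ∧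
  ∀ u v : 𝓢(RN N, ℂ),
    Integrable (fun p : RN N × RN N =>
      conj (fourierHat u p.1) * (K p.1 p.2 : ℂ) * fourierHat v p.2) ∧
    ∫ x, conj (pdo F u x) * pdo F v x =
      κ * ∫ p : RN N × RN N, conj (fourierHat u p.1) * (K p.1 p.2 : ℂ) * fourierHat v p.2

/-- The approximation error `inf ‖F(D, x) - G(D, x)‖_HS` of `K` at rank `r`, over all `F ∈ Sym(K)` and all symbols `G` with
`dim R[O_G†] = r`. -/
def approxError (κ : ℝ) (K : RN N → RN N → ℝ) (r : ℕ) : ℝ≥0∞ :=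
  ⨅ (F : RN N → RN N → ℂ) (G : RN N → RN N → ℂ) (_ : MemSym κ K F) (_ : IsSymbol G)
    (_ : Module.rank ℂ (rangeAdjoint G) = r),
      hsNorm (fun f x => pdoRight F f x - pdoRight G f x)

end

/-! As `F + δF` is an admissible representative of `K`, it is enough to find, for each ε > 0, a
symbol `G` of rank exactly `n` with `F + δF - G` in L² of norm at most the tail of the singular
values plus ε.

Passing from kernels to operators costs at most a factor 1 (`hsNorm_pdoRight_sub_le`): up to a
unimodular factor, conjugation and swap, `F(D, x) - G(D, x)` has the kernel `F - G` composed with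
𝓕⁻¹, which is (2π)^(N/2) times an isometry, and the prefactor (2π)^(-N) more than compensates. Hence
c = 1.

Schmidt's theorem (`exists_tensor_sum_approx`) approximates `δF` by `n - d` rank-one kernels with
exactly the tail as a bound. Adding them to `F` need not give a symbol, as singular functions are
merely L², nor rank exactly `n`. Both defects are repaired by an arbitrarily small perturbation
(`exists_symbol_approx_rank_add`): each factor is replaced by a nearby Schwartz function, chosen
generically so that every term raises the rank by exactly one. Genericity is available because test
functions form an infinite-dimensional space while the range of O_F† is finite-dimensional. -/

open MeasureTheory
open scoped ENNReal NNReal SchwartzMap ContDiff ComplexConjugate InnerProductSpace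

noncomputable section

/-! ### Hilbert–Schmidt kernels: Bessel, Parseval, truncation and compactness -/

section HilbertSchmidt

variable {α : Type*} [MeasurableSpace α] {μ : Measure α}

/-- The kernel `a(x) b(y)` of an operator of rank at most one. -/
def tensor (a b : α → ℂ) (x y : α) : ℂ := a x * b y

theorem MeasureTheory.MemLp.conj_fun {f : α → ℂ} {p : ℝ≥0∞} (hf : MemLp f p μ) :
    MemLp (fun x => conj (f x)) p μ := by
  refine ⟨RCLike.continuous_conj.comp_aestronglyMeasurable hf.1, ?_⟩
  rw [eLpNorm_congr_norm_ae (g := f) (by simp)]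
  exact hf.2

theorem integral_mul_eq_inner {f : α → ℂ} (hf : MemLp f 2 μ) (g : Lp ℂ 2 μ) :
    ∫ x, f x * g x ∂μ = ⟪hf.conj_fun.toLp, g⟫_ℂ := by
  rw [L2.inner_def]
  refine integral_congr_ae ?_
  filter_upwards [hf.conj_fun.coeFn_toLp] with x hx
  simp [hx, mul_comm]

theorem integral_conj_mul_eq_inner (f g : Lp ℂ 2 μ) :
    ∫ x, conj (f x) * g x ∂μ = ⟪f, g⟫_ℂ := by
  rw [L2.inner_def]
  refine integral_congr_ae (.of_forall fun x => ?_)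
  simp [mul_comm]

variable [SFinite μ] {H : α → α → ℂ}

theorem eLpNorm_tensor {a b : α → ℂ} (ha : AEStronglyMeasurable a μ)
    (hb : AEStronglyMeasurable b μ) :
    eLpNorm (Function.uncurry (tensor a b)) 2 (μ.prod μ) = eLpNorm a 2 μ * eLpNorm b 2 μ := by
  refine (ENNReal.pow_right_strictMono two_ne_zero).injective ?_
  simp only [mul_pow, sq_eLpNorm_two]
  rw [← lintegral_prod_mul (ha.enorm.pow_const 2) (hb.enorm.pow_const 2)]
  simp [Function.uncurry_def, tensor, mul_pow, enorm_mul]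

theorem memLp_tensor {a b : α → ℂ} (ha : MemLp a 2 μ) (hb : MemLp b 2 μ) :
    MemLp (Function.uncurry (tensor a b)) 2 (μ.prod μ) := by
  refine ⟨ha.1.comp_fst.mul hb.1.comp_snd, ?_⟩
  rw [eLpNorm_tensor ha.1 hb.1]
  exact ENNReal.mul_lt_top ha.2 hb.2

theorem ae_memLp_slice (hH : MemLp (Function.uncurry H) 2 (μ.prod μ)) :
    ∀ᵐ x ∂μ, MemLp (H x) 2 μ := by
  have h2 : ∫⁻ x, eLpNorm (H x) 2 μ ^ 2 ∂μ < ⊤ := by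
    have h3 : eLpNorm (Function.uncurry H) 2 (μ.prod μ) ^ 2 < ⊤ := ENNReal.pow_lt_top hH.2
    rw [sq_eLpNorm_two, lintegral_prod _ (hH.1.enorm.pow_const 2)] at h3
    simpa only [sq_eLpNorm_two, Function.uncurry_apply_pair] using h3
  have h3 : ∀ᵐ x ∂μ, eLpNorm (H x) 2 μ ^ 2 < ⊤ := by
    refine ae_lt_top' ?_ h2.ne
    simp only [sq_eLpNorm_two]
    exact (hH.1.enorm.pow_const 2).lintegral_prod_right'
  filter_upwards [hH.1.prodMk_left, h3] with x hx1 hx3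
  exact ⟨hx1, by simpa using hx3⟩

theorem sq_eLpNorm_uncurry (hH : AEStronglyMeasurable (Function.uncurry H) (μ.prod μ)) :
    eLpNorm (Function.uncurry H) 2 (μ.prod μ) ^ 2 = ∫⁻ x, eLpNorm (H x) 2 μ ^ 2 ∂μ := by
  rw [sq_eLpNorm_two, lintegral_prod _ (hH.enorm.pow_const 2)]
  simp [sq_eLpNorm_two]

/-- For almost every x, O_H e_i (x) is the inner product of e_i with the conjugate of the slice H(x,
·). Bessel's inequality on each slice is then integrated over x. -/
theorem sum_sq_eLpNorm_intOp_le (hH : MemLp (Function.uncurry H) 2 (μ.prod μ))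
    {ι : Type*} [Fintype ι] {e : ι → Lp ℂ 2 μ} (he : Orthonormal ℂ e) :
    ∑ i, eLpNorm (intOp μ H (e i)) 2 μ ^ 2 ≤ eLpNorm (Function.uncurry H) 2 (μ.prod μ) ^ 2 := by
  simp only [sq_eLpNorm_two (intOp μ H _)]
  rw [← lintegral_finsetSum' _
    fun i _ => (intOp_memLp hH (Lp.memLp (e i))).1.enorm.pow_const 2, sq_eLpNorm_uncurry hH.1]
  refine lintegral_mono_ae ?_
  filter_upwards [ae_memLp_slice hH] with x hx
  have h1 := he.sum_inner_products_le (s := Finset.univ) hx.conj_fun.toLp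
  have h2 : eLpNorm (H x) 2 μ = ‖hx.conj_fun.toLp‖ₑ := by
    rw [Lp.enorm_toLp]
    exact eLpNorm_congr_norm_ae (by simp)
  rw [h2]
  simp only [intOp, integral_mul_eq_inner hx, ← ofReal_norm, norm_inner_symm _ (e _)]
  rw [← ENNReal.ofReal_pow (norm_nonneg _)]
  simp only [← ENNReal.ofReal_pow (norm_nonneg _)]
  rw [← ENNReal.ofReal_sum_of_nonneg (fun i _ => by positivity)]
  exact ENNReal.ofReal_le_ofReal h1

theorem HilbertBasis.tsum_sq_enorm_inner {ι E : Type*} [NormedAddCommGroup E]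
    [InnerProductSpace ℂ E] (b : HilbertBasis ι ℂ E) (x : E) :
    ∑' i, ‖⟪x, b i⟫_ℂ‖ₑ ^ 2 = ‖x‖ₑ ^ 2 := by
  have h1 := b.hasSum_inner_mul_inner x x
  have h2 : HasSum (fun i => ‖⟪x, b i⟫_ℂ‖ ^ 2) (‖x‖ ^ 2) := by
    have h3 := (Complex.reCLM.hasSum h1)
    rw [inner_self_eq_norm_sq_to_K] at h3
    convert h3 using 1
    · ext i
      rw [← inner_conj_symm (b i) x, Complex.reCLM_apply, Complex.mul_conj,
        Complex.normSq_eq_norm_sq]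
      norm_cast
    · simp only [Complex.reCLM_apply]
      norm_cast
  simp only [← ofReal_norm, ← ENNReal.ofReal_pow (norm_nonneg _)]
  rw [← h2.tsum_eq, ENNReal.ofReal_tsum_of_nonneg (fun _ => by positivity) h2.summable]

/-- The same slicing with Parseval in place of Bessel; countability of the basis permits exchanging
the sum and the integral. -/
theorem tsum_sq_eLpNorm_intOp (hH : MemLp (Function.uncurry H) 2 (μ.prod μ))
    {ι : Type*} [Countable ι] (e : HilbertBasis ι ℂ (Lp ℂ 2 μ)) :
    ∑' i, eLpNorm (intOp μ H (e i)) 2 μ ^ 2 = eLpNorm (Function.uncurry H) 2 (μ.prod μ) ^ 2 := by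
  simp only [sq_eLpNorm_two (intOp μ H _)]
  rw [← lintegral_tsum
    fun i => (intOp_memLp hH (Lp.memLp (e i))).1.enorm.pow_const 2, sq_eLpNorm_uncurry hH.1]
  refine lintegral_congr_ae ?_
  filter_upwards [ae_memLp_slice hH] with x hx
  have h2 : eLpNorm (H x) 2 μ = ‖hx.conj_fun.toLp‖ₑ := by
    rw [Lp.enorm_toLp]
    exact eLpNorm_congr_norm_ae (by simp)
  rw [h2, ← e.tsum_sq_enorm_inner]
  simp only [intOp, integral_mul_eq_inner hx]

/-- The kernel of `O_H (1 - P)`, where `P` is the orthogonal projection onto the span of the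
`e i`, `i ∈ s`, for an orthonormal family `e`. -/
def truncKernel (μ : Measure α) (H : α → α → ℂ) {ι : Type*} (e : ι → Lp ℂ 2 μ) (s : Finset ι)
    (x y : α) : ℂ :=
  H x y - ∑ i ∈ s, tensor (intOp μ H (e i)) (fun y => conj (e i y)) x y

theorem memLp_truncKernel (hH : MemLp (Function.uncurry H) 2 (μ.prod μ)) {ι : Type*}
    (e : ι → Lp ℂ 2 μ) (s : Finset ι) :
    MemLp (Function.uncurry (truncKernel μ H e s)) 2 (μ.prod μ) := by
  have := hH.sub (memLp_finsetSum s
    fun i _ => memLp_tensor (intOp_memLp hH (Lp.memLp (e i))) (Lp.memLp (e i)).conj_fun)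
  exact this

theorem intOp_truncKernel (hH : MemLp (Function.uncurry H) 2 (μ.prod μ)) {ι : Type*}
    (e : ι → Lp ℂ 2 μ) (s : Finset ι) (u : Lp ℂ 2 μ) :
    intOp μ (truncKernel μ H e s) u =ᵐ[μ]
      fun x => intOp μ H u x - ∑ i ∈ s, ⟪e i, u⟫_ℂ * intOp μ H (e i) x := by
  filter_upwards [intOp_ae_integrable hH (Lp.memLp u)] with x hx
  have h1 : ∀ i, Integrable (fun y => conj (e i y) * u y) μ := fun i =>
    (Lp.memLp (e i)).conj_fun.integrable_mul (Lp.memLp u)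
  simp only [intOp, truncKernel, tensor, sub_mul, Finset.sum_mul, mul_assoc]
  rw [integral_sub hx (integrable_finsetSum _ fun i _ => (h1 i).const_mul _),
    integral_finsetSum _ fun i _ => (h1 i).const_mul _]
  congr 1
  refine Finset.sum_congr rfl fun i _ => ?_
  rw [integral_const_mul, integral_conj_mul_eq_inner, mul_comm]

/-- The truncated operator kills e_j for j ∈ s and agrees with O_H on the other basis vectors, so
Parseval leaves only the terms outside s. -/
theorem sq_eLpNorm_truncKernel (hH : MemLp (Function.uncurry H) 2 (μ.prod μ)) {ι : Type*}
    [Countable ι] (e : HilbertBasis ι ℂ (Lp ℂ 2 μ)) (s : Finset ι) :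
    eLpNorm (Function.uncurry (truncKernel μ H e s)) 2 (μ.prod μ) ^ 2 =
      ∑' i : {i // i ∉ s}, eLpNorm (intOp μ H (e i)) 2 μ ^ 2 := by
  classical
  rw [← tsum_sq_eLpNorm_intOp (memLp_truncKernel hH e s) e]
  refine Eq.trans ?_ (tsum_subtype {i | i ∉ s} (fun i => eLpNorm (intOp μ H (e i)) 2 μ ^ 2)).symm
  refine tsum_congr fun j => ?_
  rw [eLpNorm_congr_ae (intOp_truncKernel hH e s (e j))]
  simp only [orthonormal_iff_ite.1 e.orthonormal, ite_mul, one_mul, zero_mul,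
    Finset.sum_ite_eq']
  by_cases hj : j ∈ s <;> simp [hj]

theorem enorm_intOpL2_le (hH : MemLp (Function.uncurry H) 2 (μ.prod μ)) :
    ‖intOpL2 H hH‖ₑ ≤ eLpNorm (Function.uncurry H) 2 (μ.prod μ) := by
  rw [← ofReal_norm]
  refine ENNReal.ofReal_le_of_le_toReal ?_
  exact LinearMap.mkContinuous_norm_le _ ENNReal.toReal_nonneg _

theorem enorm_intOpL2_apply (hH : MemLp (Function.uncurry H) 2 (μ.prod μ)) (u : Lp ℂ 2 μ) :
    ‖intOpL2 H hH u‖ₑ = eLpNorm (intOp μ H u) 2 μ := by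
  rw [Lp.enorm_def, eLpNorm_congr_ae (intOpL2_coeFn hH u)]

theorem intOpL2_truncKernel (hH : MemLp (Function.uncurry H) 2 (μ.prod μ)) {ι : Type*}
    (e : ι → Lp ℂ 2 μ) (s : Finset ι) :
    intOpL2 (truncKernel μ H e s) (memLp_truncKernel hH e s) =
      intOpL2 H hH - ∑ i ∈ s, (innerSL ℂ (e i)).smulRight (intOpL2 H hH (e i)) := by
  ext1 u
  refine Lp.ext ?_
  simp only [sub_apply, sum_apply,
    ContinuousLinearMap.smulRight_apply, innerSL_apply_apply]
  have h1 : ∀ᵐ x ∂μ, ∀ i ∈ s, (⟪e i, u⟫_ℂ • intOpL2 H hH (e i) : Lp ℂ 2 μ) x =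
      ⟪e i, u⟫_ℂ * intOp μ H (e i) x := by
    rw [Filter.eventually_all_finset]
    intro i _
    filter_upwards [Lp.coeFn_smul ⟪e i, u⟫_ℂ (intOpL2 H hH (e i)), intOpL2_coeFn hH (e i)]
      with x hx hx'
    rw [hx, Pi.smul_apply, hx', smul_eq_mul]
  filter_upwards [intOpL2_coeFn (memLp_truncKernel hH e s) u, intOp_truncKernel hH e s u,
    Lp.coeFn_sub (intOpL2 H hH u) (∑ i ∈ s, ⟪e i, u⟫_ℂ • intOpL2 H hH (e i)),
    intOpL2_coeFn hH u, h1, Lp.coeFn_finsetSum s fun i => ⟪e i, u⟫_ℂ • intOpL2 H hH (e i)]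
    with x h2 h3 h4 h5 h6 h7
  rw [h2, h3, h4, Pi.sub_apply, h5, h7]
  rw [Finset.sum_apply, Finset.sum_congr rfl h6]

theorem isCompactOperator_smulRight {E E' : Type*} [NormedAddCommGroup E] [NormedSpace ℂ E]
    [NormedAddCommGroup E'] [NormedSpace ℂ E'] (f : E →L[ℂ] ℂ) (v : E') :
    IsCompactOperator (f.smulRight v) := by
  exact (isCompactOperator_of_locallyCompactSpace_dom f).clm_comp
    (ContinuousLinearMap.toSpanSingleton ℂ v)

/-- Orthonormal vectors are √2 apart, so the balls of radius 1/2 about them are disjoint open sets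
in a separable space. -/
theorem Orthonormal.countable {ι E : Type*} [NormedAddCommGroup E] [InnerProductSpace ℂ E]
    [TopologicalSpace.SeparableSpace E] {e : ι → E} (he : Orthonormal ℂ e) : Countable ι := by
  refine Pairwise.countable_of_isOpen_disjoint (s := fun i => Metric.ball (e i) (1 / 2)) ?_
    (fun i => Metric.isOpen_ball) fun i => ⟨e i, by simp⟩
  intro i j hij
  refine Metric.ball_disjoint_ball ?_
  have h2 : dist (e i) (e j) ^ 2 = 2 := by
    rw [dist_eq_norm, @norm_sub_sq ℂ, he.1, he.1, he.2 hij]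
    norm_num
  nlinarith [dist_nonneg (x := e i) (y := e j)]

/-- The finite-rank truncations converge in operator norm, since that norm is dominated by the L²
norm of the truncated kernel, a tail of a convergent series. -/
theorem isCompactOperator_intOpL2 [IsSeparable μ] (hH : MemLp (Function.uncurry H) 2 (μ.prod μ)) :
    IsCompactOperator (intOpL2 H hH) := by
  obtain ⟨w, e, -⟩ := exists_hilbertBasis ℂ (Lp ℂ 2 μ)
  have : Fact ((2 : ℝ≥0∞) ≠ ⊤) := ⟨by simp⟩
  have : Countable w := e.orthonormal.countable
  refine isCompactOperator_of_tendsto (l := Filter.atTop)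
    (F := fun s : Finset w => ∑ i ∈ s, (innerSL ℂ (e i)).smulRight (intOpL2 H hH (e i))) ?_
    (.of_forall fun s => ?_)
  · rw [tendsto_iff_edist_tendsto_0]
    have h0 := ENNReal.tendsto_tsum_compl_atTop_zero
      (f := fun i => eLpNorm (intOp μ H (e i)) 2 μ ^ 2)
      (by rw [tsum_sq_eLpNorm_intOp hH e]; exact (ENNReal.pow_lt_top hH.2).ne)
    have h1 := (ENNReal.continuous_rpow_const (y := 1 / 2)).tendsto _ |>.comp h0
    rw [ENNReal.zero_rpow_of_pos (by norm_num)] at h1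
    refine tendsto_of_tendsto_of_tendsto_of_le_of_le tendsto_const_nhds h1 (fun _ => zero_le)
      fun s => ?_
    rw [edist_comm, edist_eq_enorm_sub, ← intOpL2_truncKernel hH]
    refine (enorm_intOpL2_le _).trans ?_
    simp only [Function.comp_apply, ← sq_eLpNorm_truncKernel hH]
    rw [← ENNReal.rpow_natCast, ← ENNReal.rpow_mul]
    norm_num
  · exact (Submodule.sum_mem (compactOperator (RingHom.id ℂ) _ _)
      fun i _ => isCompactOperator_smulRight _ _)

end HilbertSchmidt

/-! ### Singular vectors of compact operators and Schmidt approximation -/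

section SingularValues

section Abstract

variable {E : Type*} [NormedAddCommGroup E] [InnerProductSpace ℂ E] [CompleteSpace E]
  {T : E →L[ℂ] E} {σ : ℕ → ℝ}

theorem isSymmetric_adjoint_comp_self (T : E →L[ℂ] E) :
    (T.adjoint ∘L T).toLinearMap.IsSymmetric := by
  intro x y
  simp [ContinuousLinearMap.adjoint_inner_left, ContinuousLinearMap.adjoint_inner_right]

theorem inner_adjoint_comp_self (T : E →L[ℂ] E) (x : E) :
    ⟪x, (T.adjoint ∘L T) x⟫_ℂ = ((‖T x‖ ^ 2 : ℝ) : ℂ) := by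
  rw [ContinuousLinearMap.comp_apply, ContinuousLinearMap.adjoint_inner_right,
    inner_self_eq_norm_sq_to_K]
  norm_cast

theorem eq_zero_or_eq_sq_of_mem_eigenspace {c : ℂ} {x : E} (hx : x ≠ 0)
    (h : x ∈ Module.End.eigenspace (T.adjoint ∘L T).toLinearMap c) :
    c = 0 ∨ ∃ s : ℝ, 0 < s ∧ c = (s : ℂ) ^ 2 := by
  have h1 := Module.End.mem_eigenspace_iff.1 h
  have h2 := inner_adjoint_comp_self T x
  simp only [ContinuousLinearMap.coe_coe] at h1
  rw [h1, inner_smul_right, inner_self_eq_norm_sq_to_K] at h2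
  have hx' : ((‖x‖ : ℝ) : ℂ) ≠ 0 := by exact_mod_cast norm_ne_zero_iff.2 hx
  have h3 : c = ((‖T x‖ / ‖x‖ : ℝ) : ℂ) ^ 2 := by
    push_cast
    rw [div_pow, eq_div_iff (pow_ne_zero 2 hx')]
    simpa using h2
  rcases (div_nonneg (norm_nonneg (T x)) (norm_nonneg x)).eq_or_lt with h0 | h0
  · left
    rw [h3, ← h0]
    simp
  · exact Or.inr ⟨_, h0, h3⟩

/-- Compactness makes the eigenspace for s² ≠ 0 finite-dimensional, so its dimension equals the
number of indices i with σ i = s, and those indices can label an orthonormal basis. -/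
theorem exists_basis_eigenspace (hT : IsCompactOperator T) (hσ : IsSingularValueSeq T σ) {s : ℝ}
    (hs : 0 < s) : ∃ b : {i | σ i = s} → E, Orthonormal ℂ b ∧
      (∀ i, b i ∈ Module.End.eigenspace (T.adjoint ∘L T).toLinearMap ((s : ℂ) ^ 2)) ∧
      Module.End.eigenspace (T.adjoint ∘L T).toLinearMap ((s : ℂ) ^ 2) ≤
        Submodule.span ℂ (Set.range b) := by
  set V := Module.End.eigenspace (T.adjoint ∘L T).toLinearMap ((s : ℂ) ^ 2) with hV
  have hc : IsCompactOperator (T.adjoint ∘L T) := hT.clm_comp T.adjoint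
  have : FiniteDimensional ℂ V := ContinuousLinearMap.finite_dimensional_eigenspace hc _
    (pow_ne_zero 2 (by exact_mod_cast hs.ne'))
  have h1 := hσ.multiplicity s hs
  rw [← hV, ← Module.finrank_eq_rank, Cardinal.toENat_nat] at h1
  have hf : {i | σ i = s}.Finite := Set.finite_of_encard_eq_coe h1
  have := hf.fintype
  have h2 : Fintype.card {i | σ i = s} = Fintype.card (Fin (Module.finrank ℂ V)) := by
    rw [Fintype.card_fin, ← Nat.card_eq_fintype_card, Nat.card_coe_set_eq, Set.ncard, h1]
    simp
  let f := Fintype.equivOfCardEq h2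
  let B := (stdOrthonormalBasis ℂ V).reindex f.symm
  refine ⟨fun i => (B i : E), ?_, fun i => (B i).2, fun x hx => ?_⟩
  · exact B.orthonormal.comp_linearIsometry V.subtypeₗᵢ
  · have h3 := congrArg V.subtype (B.sum_repr ⟨x, hx⟩)
    rw [map_sum] at h3
    simp only [Submodule.subtype_apply] at h3
    rw [← h3]
    exact Submodule.sum_mem _ fun i _ => Submodule.smul_mem _ _ (Submodule.subset_span ⟨i, rfl⟩)

/-- A compact operator with the singular values `σ` has an orthonormal family of right singular
vectors, and vanishes on the orthogonal complement of their span. -/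
theorem exists_right_singular_vectors (hT : IsCompactOperator T) (hσ : IsSingularValueSeq T σ) :
    ∃ v : {i // 0 < σ i} → E, Orthonormal ℂ v ∧ (∀ i, ‖T (v i)‖ = σ i) ∧
      ∀ x, (∀ i, ⟪v i, x⟫_ℂ = 0) → T x = 0 := by
  have hsym := isSymmetric_adjoint_comp_self T
  have hc : IsCompactOperator (T.adjoint ∘L T) := hT.clm_comp T.adjoint
  choose b hb hbV hVb using fun s : {s : ℝ // 0 < s} => exists_basis_eigenspace hT hσ s.2
  let v : {i // 0 < σ i} → E := fun i => b ⟨σ i, i.2⟩ ⟨i, rfl⟩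
  have hv : ∀ (s : {s : ℝ // 0 < s}) (i : ℕ) (h : σ i = s),
      b s ⟨i, h⟩ = v ⟨i, h ▸ s.2⟩ := by
    rintro ⟨s, hs⟩ i h
    obtain rfl : σ i = s := h
    rfl
  have hvV : ∀ i, v i ∈ Module.End.eigenspace (T.adjoint ∘L T).toLinearMap ((σ i.1 : ℂ) ^ 2) :=
    fun i => hbV ⟨σ i, i.2⟩ ⟨i, rfl⟩
  have hv1 : ∀ i, ‖v i‖ = 1 := fun i => (hb ⟨σ i, i.2⟩).1 ⟨i, rfl⟩
  refine ⟨v, ⟨hv1, ?_⟩, ?_, ?_⟩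
  · intro i j hij
    by_cases h : σ i = σ j
    · have h1 : v j = b ⟨σ i, i.2⟩ ⟨j, h.symm⟩ := (hv _ _ _).symm
      rw [h1]
      exact (hb ⟨σ i, i.2⟩).2 fun h2 => hij (Subtype.ext (Subtype.mk.inj h2))
    · have h1 : (σ i : ℂ) ^ 2 ≠ (σ j : ℂ) ^ 2 := by
        intro h2
        norm_cast at h2
        exact h ((pow_left_inj₀ i.2.le j.2.le two_ne_zero).1 h2)
      exact hsym.orthogonalFamily_eigenspaces h1 ⟨v i, hvV i⟩ ⟨v j, hvV j⟩
  · intro i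
    have h1 := inner_adjoint_comp_self T (v i)
    have h2 := Module.End.mem_eigenspace_iff.1 (hvV i)
    simp only [ContinuousLinearMap.coe_coe] at h2
    rw [h2, inner_smul_right, inner_self_eq_norm_sq_to_K, hv1, RCLike.ofReal_one,
      one_pow, mul_one] at h1
    norm_cast at h1
    exact ((pow_left_inj₀ i.2.le (norm_nonneg _) two_ne_zero).1 h1).symm
  · intro x hx
    -- T†T x is orthogonal to every eigenspace: to the kernel because T†T is symmetric, to the
    -- others because x is. The spectral theorem then gives T†T x = 0, and ‖T x‖² = ⟪x, T†T x⟫.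
    have h1 : (T.adjoint ∘L T) x ∈
        (⨆ c, Module.End.eigenspace (T.adjoint ∘L T).toLinearMap c)ᗮ := by
      rw [← Submodule.iInf_orthogonal, Submodule.mem_iInf]
      intro c y hy
      by_cases hy0 : y = 0
      · simp [hy0]
      have h2 : ⟪y, (T.adjoint ∘L T) x⟫_ℂ = conj c * ⟪y, x⟫_ℂ := by
        have h3 := hsym y x
        rw [Module.End.mem_eigenspace_iff.1 hy, inner_smul_left] at h3
        exact h3.symm
      rw [h2]
      rcases eq_zero_or_eq_sq_of_mem_eigenspace hy0 hy with rfl | ⟨s, hs, rfl⟩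
      · simp
      · have h4 : y ∈ (ℂ ∙ x)ᗮ := by
          refine Submodule.span_le.2 ?_ (hVb ⟨s, hs⟩ hy)
          rintro _ ⟨⟨i, hi⟩, rfl⟩
          rw [hv, SetLike.mem_coe, Submodule.mem_orthogonal_singleton_iff_inner_left]
          exact hx _
        rw [Submodule.mem_orthogonal_singleton_iff_inner_left.1 h4, mul_zero]
    rw [ContinuousLinearMap.orthogonalComplement_iSup_eigenspaces_eq_bot hc hsym,
      Submodule.mem_bot] at h1
    have h2 := inner_adjoint_comp_self T x
    rw [h1, inner_zero_right] at h2
    norm_cast at h2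
    exact norm_eq_zero.1 (pow_eq_zero_iff two_ne_zero |>.1 h2.symm)

end Abstract

variable {α : Type*} [MeasurableSpace α] {μ : Measure α} [SFinite μ] [IsSeparable μ]
  {H : α → α → ℂ} {σ : ℕ → ℝ}

/-- **Schmidt's approximation theorem** (the part that gives the upper bound). -/
theorem exists_tensor_sum_approx (hH : MemLp (Function.uncurry H) 2 (μ.prod μ))
    (hσ : IsSingularValueSeq (intOpL2 H hH) σ) (k : ℕ) :
    ∃ a b : ℕ → α → ℂ, (∀ i, MemLp (a i) 2 μ) ∧ (∀ i, MemLp (b i) 2 μ) ∧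
      eLpNorm (Function.uncurry fun x y =>
          H x y - ∑ i ∈ Finset.range k, tensor (a i) (b i) x y) 2 (μ.prod μ) ^ 2 ≤
        ∑' i, ENNReal.ofReal (σ (k + i) ^ 2) := by
  classical
  have : Fact ((2 : ℝ≥0∞) ≠ ⊤) := ⟨by simp⟩
  obtain ⟨v, hv, hTv, hker⟩ := exists_right_singular_vectors (isCompactOperator_intOpL2 hH) hσ
  -- Completing the singular vectors to a Hilbert basis makes the exact Parseval formula for
  -- truncated kernels applicable.
  obtain ⟨w, e, hvw, he⟩ := hv.toSubtypeRange.exists_hilbertBasis_extension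
  have : Countable w := e.orthonormal.countable
  let j : {i // 0 < σ i} ↪ w := ⟨fun i => ⟨v i, hvw ⟨i, rfl⟩⟩,
    fun i i' h => hv.linearIndependent.injective (congrArg Subtype.val h)⟩
  have hej : ∀ i, e (j i) = v i := fun i => by rw [he]; rfl
  let s : Finset w := ((Finset.range k).subtype fun i => 0 < σ i).map j
  have hjs : ∀ i, j i ∈ s ↔ i.1 < k := fun i => by
    simp [s]
  -- The terms with σ i = 0 are zero, so that the sum always has k terms even if fewer singular
  -- vectors exist.
  let a : ℕ → α → ℂ := fun i => if h : 0 < σ i then intOp μ H (v ⟨i, h⟩) else 0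
  let b : ℕ → α → ℂ := fun i => if h : 0 < σ i then fun y => conj (v ⟨i, h⟩ y) else 0
  have ha : ∀ i, MemLp (a i) 2 μ := fun i => by
    by_cases h : 0 < σ i
    · simpa only [a, h, dite_true] using intOp_memLp hH (Lp.memLp (v ⟨i, h⟩))
    · simp only [a, h, dite_false]
      exact MemLp.zero
  have hb : ∀ i, MemLp (b i) 2 μ := fun i => by
    by_cases h : 0 < σ i
    · simpa only [b, h, dite_true] using (Lp.memLp (v ⟨i, h⟩)).conj_fun
    · simp only [b, h, dite_false]
      exact MemLp.zero
  refine ⟨a, b, ha, hb, ?_⟩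
  have hsum : (fun x y => H x y - ∑ i ∈ Finset.range k, tensor (a i) (b i) x y) =
      truncKernel μ H e s := by
    ext x y
    rw [truncKernel, Finset.sum_map]
    congr 1
    have h1 : ∀ i : {i // 0 < σ i}, tensor (intOp μ H (e (j i))) (fun y => conj (e (j i) y)) x y =
        tensor (a i) (b i) x y := fun i => by
      simp only [a, b, i.2, dite_true, hej]
    simp only [h1]
    rw [Finset.sum_subtype_eq_sum_filter (f := fun i => tensor (a i) (b i) x y)]
    refine (Finset.sum_filter_of_ne fun i _ hi => ?_).symm
    by_contra h
    simp [tensor, a, h] at hi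
  rw [hsum, sq_eLpNorm_truncKernel hH]
  -- `g` lists the singular vectors not removed by the truncation; only they contribute to the
  -- remaining sum.
  let g : {m : ℕ // k ≤ m ∧ 0 < σ m} → {i // i ∉ s} := fun m =>
    ⟨j ⟨m, m.2.2⟩, by rw [hjs]; exact not_lt.2 m.2.1⟩
  have hg : Function.Injective g := fun m m' h => by
    have := j.injective (Subtype.mk.inj h)
    exact Subtype.ext (Subtype.mk.inj this)
  rw [← hg.tsum_eq]
  · let q : {m : ℕ // k ≤ m ∧ 0 < σ m} → ℕ := fun m => m - k
    have hq : Function.Injective q := fun m m' h => by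
      have := m.2.1
      have := m'.2.1
      exact Subtype.ext (by simp only [q] at h; omega)
    refine le_trans (le_of_eq (tsum_congr fun m => ?_)) (ENNReal.tsum_comp_le_tsum_of_injective hq _)
    simp only [g, q, hej, Nat.add_sub_cancel' m.2.1]
    rw [← enorm_intOpL2_apply hH, ← ofReal_norm, hTv, ENNReal.ofReal_pow m.2.2.le]
  -- A basis vector not killed by O_H cannot be orthogonal to all v m, hence is one of them; lying
  -- outside s, it has index m ≥ k.
  · rintro ⟨i, hi⟩ h
    have h1 : intOpL2 H hH (e i) ≠ 0 := fun h0 => by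
      simp [← enorm_intOpL2_apply hH, h0] at h
    have h2 : ¬ ∀ m, ⟪v m, e i⟫_ℂ = 0 := fun h2 => h1 (hker _ h2)
    push Not at h2
    obtain ⟨m, hm⟩ := h2
    have h3 : j m = i := by
      by_contra h3
      rw [← hej] at hm
      exact hm (e.orthonormal.2 h3)
    subst h3
    exact ⟨⟨m, not_lt.1 fun h4 => hi ((hjs m).2 h4), m.2⟩, rfl⟩

end SingularValues

/-! ### Symbols, the rank of O_F† under rank-one perturbations, and generic Schwartz approximation
-/

section Symbols

/-- Joint smoothness of the y-derivatives is what lets the x-derivatives in the symbol estimates be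
taken termwise. -/
theorem contDiff_iteratedFDeriv_snd {F : RN N → RN N → ℂ} (hF : ContDiff ℝ ∞ (Function.uncurry F))
    (a : ℕ) : ContDiff ℝ ∞ (Function.uncurry fun x y => iteratedFDeriv ℝ a (F x) y) := by
  induction a with
  | zero =>
    simp only [iteratedFDeriv_zero_eq_comp, Function.comp_def]
    exact (continuousMultilinearCurryFin0 ℝ (RN N) ℂ).symm.contDiff.comp hF
  | succ a ih =>
    simp only [iteratedFDeriv_succ_eq_comp_left, Function.comp_def]
    have h0 : ContDiff ℝ ∞
        (continuousMultilinearCurryLeftEquiv ℝ (fun _ : Fin (a + 1) => RN N) ℂ).symm :=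
      LinearIsometryEquiv.contDiff (𝕜 := ℝ) (E := RN N →L[ℝ] (RN N [×a]→L[ℝ] ℂ))
        (F := RN N [×(a + 1)]→L[ℝ] ℂ) _
    refine h0.comp ?_
    have h1 : ContDiff ℝ ∞ (Function.uncurry fun (p : RN N × RN N) (y : RN N) =>
        iteratedFDeriv ℝ a (F p.1) y) :=
      ih.comp ((contDiff_fst.comp contDiff_fst).prodMk contDiff_snd)
    exact ContDiff.fderiv h1 contDiff_snd (by simp)

theorem SymbolClass.add {m : ℝ} {F G : RN N → RN N → ℂ} (hF : SymbolClass m F)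
    (hG : SymbolClass m G) : SymbolClass m (F + G) := by
  refine ⟨hF.1.add hG.1, fun Ω hΩ a b => ?_⟩
  obtain ⟨C, hC, h1⟩ := hF.2 Ω hΩ a b
  obtain ⟨C', hC', h2⟩ := hG.2 Ω hΩ a b
  refine ⟨C + C', add_pos hC hC', fun x hx y => ?_⟩
  have hs : ∀ {F : RN N → RN N → ℂ}, ContDiff ℝ ∞ (Function.uncurry F) → ∀ x,
      ContDiff ℝ a (F x) := fun h x =>
    (h.comp (contDiff_prodMk_right x)).of_le (by exact_mod_cast le_top)
  have hs' : ∀ {F : RN N → RN N → ℂ}, ContDiff ℝ ∞ (Function.uncurry F) →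
      ContDiff ℝ b (fun x => iteratedFDeriv ℝ a (F x) y) := fun h =>
    ((contDiff_iteratedFDeriv_snd h a).comp (contDiff_prodMk_left y)).of_le
      (by exact_mod_cast le_top)
  have h3 : (fun x' => iteratedFDeriv ℝ a (fun y' => (F + G) x' y') y) =
      (fun x' => iteratedFDeriv ℝ a (F x') y) + fun x' => iteratedFDeriv ℝ a (G x') y := by
    funext x'
    exact iteratedFDeriv_add_apply (hs hF.1 x').contDiffAt (hs hG.1 x').contDiffAt
  rw [h3, iteratedFDeriv_add_apply (hs' hF.1).contDiffAt (hs' hG.1).contDiffAt, add_mul]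
  exact (norm_add_le _ _).trans (add_le_add (h1 x hx y) (h2 x hx y))

/-- Schwartz decay gives |D^a v(y)| ≤ C (1 + |y|)^(-a), already stronger than the bound of order m ≥
0, and x-derivatives fall on `u` alone. -/
theorem symbolClass_tensor {m : ℝ} (hm : 0 ≤ m) (u v : 𝓢(RN N, ℂ)) :
    SymbolClass m (tensor u v) := by
  refine ⟨((u.smooth ⊤).comp contDiff_fst).mul ((v.smooth ⊤).comp contDiff_snd),
    fun Ω _ a b => ?_⟩
  obtain ⟨C, hC, h1⟩ := u.decay 0 b
  have h2 := SchwartzMap.one_add_le_sup_seminorm_apply (𝕜 := ℝ) (m := (a, a)) le_rfl le_rfl v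
  set C' := 2 ^ a * ((Finset.Iic (a, a)).sup fun m => SchwartzMap.seminorm ℝ m.1 m.2) v
  have hC' : 0 ≤ C' := (by positivity : (0:ℝ) ≤ _).trans (h2 0)
  -- The summand 1 keeps the constant positive when C' = 0.
  refine ⟨C * (C' + 1), by positivity, fun x _ y => ?_⟩
  have hv : ContDiff ℝ a v := v.smooth a
  -- For fixed y, the a-th y-derivative is the linear map c ↦ c • D^a v(y) applied to u(x).
  set L : ℂ →L[ℝ] (RN N [×a]→L[ℝ] ℂ) :=
    (ContinuousLinearMap.toSpanSingleton ℂ (iteratedFDeriv ℝ a v y)).restrictScalars ℝ with hL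
  have h3 : (fun x' => iteratedFDeriv ℝ a (fun y' => tensor u v x' y') y) = L ∘ u := by
    funext x'
    exact iteratedFDeriv_const_smul_apply' (a := u x') hv.contDiffAt
  have h4 := L.norm_iteratedFDeriv_comp_left (n := b) (x := x) (u.smooth b).contDiffAt le_rfl
  have h5 : ‖L‖ = ‖iteratedFDeriv ℝ a v y‖ := by
    rw [hL, ContinuousLinearMap.norm_restrictScalars, ContinuousLinearMap.norm_toSpanSingleton]
  have hy : 0 < 1 + ‖y‖ := by positivity
  have h6 : ‖iteratedFDeriv ℝ a v y‖ ≤ C' * (1 + ‖y‖) ^ (m - a) := by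
    have h7 : ‖iteratedFDeriv ℝ a v y‖ ≤ C' / (1 + ‖y‖) ^ a := by
      rw [le_div_iff₀ (by positivity), mul_comm]
      exact h2 y
    refine h7.trans ?_
    rw [Real.rpow_sub hy, Real.rpow_natCast, ← mul_div_assoc]
    gcongr
    exact le_mul_of_one_le_right hC' (Real.one_le_rpow (by simp) hm)
  rw [h3]
  have h8 : ‖iteratedFDeriv ℝ b u x‖ ≤ C := by simpa using h1 x
  calc _ ≤ ‖L‖ * ‖iteratedFDeriv ℝ b u x‖ := h4
    _ ≤ (C' * (1 + ‖y‖) ^ (m - a)) * C := by rw [h5]; gcongr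
    _ ≤ ((C' + 1) * (1 + ‖y‖) ^ (m - a)) * C := by gcongr; simp
    _ = _ := by ring

theorem IsSymbol.add_tensor {F : RN N → RN N → ℂ} (hF : IsSymbol F) (u v : 𝓢(RN N, ℂ)) :
    IsSymbol (F + tensor u v) := by
  obtain ⟨m, hm⟩ := hF
  exact ⟨m, hm.add (symbolClass_tensor m.cast_nonneg u v)⟩

theorem IsSymbol.continuous {F : RN N → RN N → ℂ} (hF : IsSymbol F) :
    Continuous (Function.uncurry F) := by
  obtain ⟨m, hm⟩ := hF
  exact hm.1.continuous

/-- The space `C_c^∞(ℝ^N)` of test functions. -/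
def testFunctions (N : ℕ) : Submodule ℂ 𝓢(RN N, ℂ) where
  carrier := {u | HasCompactSupport u}
  add_mem' hu hv := by exact hu.add hv
  zero_mem' := by exact HasCompactSupport.zero
  smul_mem' c u hu := by exact HasCompactSupport.smul_left (f := fun _ => c) hu

theorem integrable_conj_mul_testFunction {F : RN N → RN N → ℂ}
    (hF : Continuous (Function.uncurry F)) (u : testFunctions N) (y : RN N) :
    Integrable fun x => conj (F x y) * u.1 x := by
  refine Continuous.integrable_of_hasCompactSupport ?_ (HasCompactSupport.mul_left u.2)
  have h1 : Continuous fun x => F x y := hF.comp (Continuous.prodMk_left y)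
  exact (RCLike.continuous_conj.comp h1).mul u.1.continuous

/-- The operator `O_F†` on test functions. -/
def intOpAdjoint (F : RN N → RN N → ℂ) (hF : Continuous (Function.uncurry F)) :
    testFunctions N →ₗ[ℂ] (RN N → ℂ) where
  toFun u := intOp volume (fun y x => conj (F x y)) u.1
  map_add' u v := by
    funext y
    simp only [intOp, Submodule.coe_add, add_apply, mul_add, Pi.add_apply]
    exact integral_add (integrable_conj_mul_testFunction hF u y)
      (integrable_conj_mul_testFunction hF v y)
  map_smul' c u := by
    funext y
    simp only [intOp, Submodule.coe_smul, smul_apply, smul_eq_mul, Pi.smul_apply,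
      RingHom.id_apply]
    rw [← integral_const_mul]
    congr 1
    funext x
    ring

theorem rangeAdjoint_eq_range {F : RN N → RN N → ℂ} (hF : Continuous (Function.uncurry F)) :
    rangeAdjoint F = LinearMap.range (intOpAdjoint F hF) := by
  refine le_antisymm (Submodule.span_le.2 ?_) ?_
  · rintro _ ⟨u, hu, rfl⟩
    exact ⟨⟨u, hu⟩, rfl⟩
  · rintro _ ⟨u, rfl⟩
    exact Submodule.subset_span ⟨u.1, u.2, rfl⟩

theorem intOpAdjoint_add_tensor {F : RN N → RN N → ℂ} (hF : Continuous (Function.uncurry F))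
    (a b : 𝓢(RN N, ℂ)) (hG : Continuous (Function.uncurry (F + tensor a b)))
    (u : testFunctions N) :
    intOpAdjoint (F + tensor a b) hG u =
      intOpAdjoint F hF u + (∫ x, conj (a x) * u.1 x) • fun y => conj (b y) := by
  funext y
  have h1 : Integrable fun x => conj (a x) * u.1 x := integrable_conj_mul_testFunction
    (F := fun x _ => a x) (a.continuous.comp continuous_fst) u 0
  simp only [intOpAdjoint, LinearMap.coe_mk, AddHom.coe_mk, intOp, Pi.add_apply, tensor, map_add,
    map_mul, add_mul, Pi.smul_apply, smul_eq_mul]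
  rw [← integral_mul_const, ← integral_add (integrable_conj_mul_testFunction hF u y)
    (h1.mul_const _)]
  congr 1
  funext x
  ring

/-- Since O_F† kills `u` but the new term does not, the perturbed range contains conj b. Hence it
also contains the old range, and it is the old range plus one new direction. -/
theorem rank_rangeAdjoint_add_tensor {F : RN N → RN N → ℂ} (hF : Continuous (Function.uncurry F))
    {d : ℕ} (hd : Module.rank ℂ (rangeAdjoint F) = d) {u : testFunctions N}
    (hu : intOpAdjoint F hF u = 0) {a b : 𝓢(RN N, ℂ)} (ha : ∫ x, conj (a x) * u.1 x ≠ 0)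
    (hb : (fun y => conj (b y)) ∉ rangeAdjoint F)
    (hG : Continuous (Function.uncurry (F + tensor a b))) :
    Module.rank ℂ (rangeAdjoint (F + tensor a b)) = (d + 1 : ℕ) := by
  have : Module.Finite ℂ (rangeAdjoint F) := by
    rw [← Module.rank_lt_aleph0_iff, hd]
    exact Cardinal.natCast_lt_aleph0
  have h1 : rangeAdjoint (F + tensor a b) =
      rangeAdjoint F ⊔ Submodule.span ℂ {fun y => conj (b y)} := by
    have hbG : (fun y => conj (b y)) ∈ rangeAdjoint (F + tensor a b) := by
      rw [rangeAdjoint_eq_range hG]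
      refine ⟨(∫ x, conj (a x) * u.1 x)⁻¹ • u, ?_⟩
      rw [map_smul, intOpAdjoint_add_tensor hF, hu, zero_add, smul_smul, inv_mul_cancel₀ ha,
        one_smul]
    refine le_antisymm ?_ (sup_le ?_ ((Submodule.span_singleton_le_iff_mem _ _).2 hbG))
    · rw [rangeAdjoint_eq_range hG]
      rintro _ ⟨v, rfl⟩
      rw [intOpAdjoint_add_tensor hF]
      refine Submodule.add_mem_sup ?_ (Submodule.smul_mem _ _ (Submodule.mem_span_singleton_self _))
      rw [rangeAdjoint_eq_range hF]
      exact ⟨v, rfl⟩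
    · rw [rangeAdjoint_eq_range hF]
      rintro _ ⟨v, rfl⟩
      have h2 := intOpAdjoint_add_tensor hF a b hG v
      rw [← sub_eq_iff_eq_add] at h2
      rw [← h2]
      refine Submodule.sub_mem _ ?_ (Submodule.smul_mem _ _ hbG)
      rw [rangeAdjoint_eq_range hG]
      exact ⟨v, rfl⟩
  have h2 := Submodule.finrank_sup_add_finrank_inf_eq (rangeAdjoint F)
    (Submodule.span ℂ {fun y => conj (b y)})
  rw [(Submodule.disjoint_span_singleton_of_notMem hb).eq_bot, finrank_bot,
    finrank_span_singleton fun h0 => hb (by rw [h0]; exact Submodule.zero_mem _),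
    Module.finrank_eq_of_rank_eq hd] at h2
  rw [h1, ← Module.finrank_eq_rank, ← h2, add_zero]

/-- Real bumps of radius 1/2 about the integer points of a coordinate axis: each is 1 at its own
centre and 0 at the others. This needs N > 0. -/
theorem exists_linearIndependent_testFunctions (hN : 0 < N) :
    ∃ f : ℕ → testFunctions N, LinearIndependent ℂ f ∧ ∀ i x, conj ((f i).1 x) = (f i).1 x := by
  let c : ℕ → RN N := fun i => EuclideanSpace.single ⟨0, hN⟩ (i : ℝ)
  have hc : ∀ i j, i ≠ j → 1 ≤ dist (c i) (c j) := fun i j hij => by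
    rw [show dist (c i) (c j) = dist (i : ℝ) (j : ℝ) from PiLp.dist_single_same 2 _ _ _ _,
      Nat.dist_cast_real]
    rw [Nat.dist_eq]
    have : (1 : ℤ) ≤ |(i : ℤ) - j| := Int.one_le_abs (sub_ne_zero.2 (by exact_mod_cast hij))
    exact_mod_cast this
  let B : ∀ i, ContDiffBump (c i) := fun i => ⟨1 / 4, 1 / 2, by norm_num, by norm_num⟩
  have hB : ∀ i, HasCompactSupport (fun x => (B i x : ℂ)) := fun i =>
    (B i).hasCompactSupport.comp_left Complex.ofReal_zero
  let f : ℕ → testFunctions N := fun i =>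
    ⟨(hB i).toSchwartzMap (Complex.ofRealCLM.contDiff.comp (B i).contDiff), hB i⟩
  have hf : ∀ i x, (f i).1 x = (B i x : ℂ) := fun i x => rfl
  refine ⟨f, ?_, fun i x => by rw [hf, Complex.conj_ofReal]⟩
  rw [linearIndependent_iff']
  intro s g hg i hi
  have h1 := congrArg (fun u : testFunctions N => u.1 (c i)) hg
  have h2 : ∀ j ∈ s, j ≠ i → g j • (f j).1 (c i) = 0 := fun j _ hj => by
    rw [hf, (B j).zero_of_le_dist, Complex.ofReal_zero, smul_zero]
    refine le_trans ?_ (hc i j hj.symm)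
    norm_num [B]
  have h3 : (∑ j ∈ s, g j • f j).1 (c i) = ∑ j ∈ s, g j • (f j).1 (c i) := by
    simp
  simp only [h3] at h1
  rw [Finset.sum_eq_single_of_mem i hi h2, hf,
    (B i).one_of_mem_closedBall (Metric.mem_closedBall_self (B i).rIn_pos.le)] at h1
  simpa using h1

theorem exists_ker_intOpAdjoint (hN : 0 < N) {F : RN N → RN N → ℂ}
    (hF : Continuous (Function.uncurry F)) [Module.Finite ℂ (rangeAdjoint F)] :
    ∃ u : testFunctions N, u ≠ 0 ∧ intOpAdjoint F hF u = 0 := by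
  by_contra! h
  obtain ⟨f, hf, -⟩ := exists_linearIndependent_testFunctions hN
  have h1 : Function.Injective (intOpAdjoint F hF).rangeRestrict := by
    rw [← LinearMap.ker_eq_bot, LinearMap.ker_rangeRestrict, LinearMap.ker_eq_bot']
    exact fun u hu => by_contra fun h0 => h u h0 hu
  have h2 := hf.map' _ (LinearMap.ker_eq_bot.2 h1)
  have : Module.Finite ℂ (LinearMap.range (intOpAdjoint F hF)) := by
    rwa [← rangeAdjoint_eq_range hF]
  exact not_finite_iff_infinite.2 inferInstance h2.finite

theorem exists_testFunction_notMem (hN : 0 < N) (V : Submodule ℂ (RN N → ℂ)) [Module.Finite ℂ V] :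
    ∃ u : 𝓢(RN N, ℂ), (fun y => conj (u y)) ∉ V := by
  by_contra! h
  obtain ⟨f, hf, hfc⟩ := exists_linearIndependent_testFunctions hN
  have h0 : ∀ i, (f i : RN N → ℂ) ∈ V := fun i => by
    simpa only [hfc] using h (f i)
  let L : testFunctions N →ₗ[ℂ] (RN N → ℂ) :=
    { toFun := fun u => u.1, map_add' := fun _ _ => rfl, map_smul' := fun _ _ => rfl }
  have hL : LinearMap.ker L = ⊥ := LinearMap.ker_eq_bot'.2 fun u hu =>
    Subtype.ext (DFunLike.coe_injective hu)
  have h2 : LinearIndependent ℂ fun i => (⟨f i, h0 i⟩ : V) :=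
    LinearIndependent.of_comp V.subtype (hf.map' L hL)
  exact not_finite_iff_infinite.2 inferInstance h2.finite

/-- `P` is a generic condition: where it fails at g, any nonzero multiple of g₀ restores it. Half of
δ pays for a smooth approximant, half for a small nudge along g₀. -/
theorem exists_schwartz_eLpNorm_sub_le {f : RN N → ℂ} (hf : MemLp f 2 volume) {δ : ℝ≥0∞}
    (hδ : δ ≠ 0) (g₀ : 𝓢(RN N, ℂ)) (P : 𝓢(RN N, ℂ) → Prop)
    (hP : ∀ g, P g ∨ ∀ t : ℂ, t ≠ 0 → P (g + t • g₀)) :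
    ∃ g, P g ∧ eLpNorm (⇑g - f) 2 volume ≤ δ := by
  have hδ2 : δ / 2 ≠ 0 := by simpa using hδ
  obtain ⟨ε, hε, hεδ⟩ := ENNReal.lt_iff_exists_real_btwn.1 (pos_iff_ne_zero.2 hδ2)
  have hε0 : 0 < ε := by simpa using hεδ.1
  obtain ⟨h, h1, h2, h3⟩ := hf.exist_eLpNorm_sub_le (by simp) (by norm_num) hε0
  let g := h1.toSchwartzMap h2
  have hg : eLpNorm (⇑g - f) 2 volume ≤ δ / 2 := by
    rw [eLpNorm_sub_comm]
    exact h3.trans hεδ.2.le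
  rcases hP g with h4 | h4
  · exact ⟨g, h4, hg.trans ENNReal.half_le_self⟩
  · have hM := (g₀.memLp 2 volume).eLpNorm_ne_top
    obtain ⟨t, ht, htδ⟩ : ∃ t : ℝ≥0, 0 < t ∧ t * eLpNorm g₀ 2 volume < δ / 2 :=
      ENNReal.exists_nnreal_pos_mul_lt hM hδ2
    refine ⟨g + (t : ℂ) • g₀, h4 _ (by exact_mod_cast ht.ne'), ?_⟩
    have h5 : ⇑(g + (t : ℂ) • g₀) - f = (⇑g - f) + (t : ℂ) • ⇑g₀ := by
      ext x
      simp
      ring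
    rw [h5, ← ENNReal.add_halves δ]
    refine (eLpNorm_add_le ((g.memLp 2 volume).1.sub hf.1) ((g₀.memLp 2 volume).1.const_smul _)
      (by norm_num)).trans (add_le_add hg ?_)
    rw [eLpNorm_const_smul]
    refine le_trans (le_of_eq ?_) htδ.le
    congr 1
    simp [enorm]

end Symbols

/-! ### Approximating L² tensors by symbols of prescribed rank -/

section Approximation

theorem exists_tensor_approx_rank_succ (hN : 0 < N) {F : RN N → RN N → ℂ}
    (hF : Continuous (Function.uncurry F)) {d : ℕ} (hd : Module.rank ℂ (rangeAdjoint F) = d)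
    {a b : RN N → ℂ} (ha : MemLp a 2 volume) (hb : MemLp b 2 volume) {ε : ℝ≥0∞} (hε : ε ≠ 0) :
    ∃ u v : 𝓢(RN N, ℂ), Module.rank ℂ (rangeAdjoint (F + tensor u v)) = (d + 1 : ℕ) ∧
      eLpNorm (Function.uncurry (tensor u v - tensor a b)) 2 (volume.prod volume) ≤ ε := by
  have : Module.Finite ℂ (rangeAdjoint F) := by
    rw [← Module.rank_lt_aleph0_iff, hd]
    exact Cardinal.natCast_lt_aleph0
  have hε2 : ε / 2 ≠ 0 := by simpa using hε
  have hδ : ∀ {w : RN N → ℂ}, MemLp w 2 volume →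
      ∃ δ : ℝ≥0∞, δ ≠ 0 ∧ δ * eLpNorm w 2 volume ≤ ε / 2 := fun hw => by
    obtain ⟨t, ht, h⟩ := ENNReal.exists_nnreal_pos_mul_lt hw.eLpNorm_ne_top hε2
    exact ⟨t, by exact_mod_cast ht.ne', h.le⟩
  obtain ⟨w, hw0, hw⟩ := exists_ker_intOpAdjoint hN hF
  obtain ⟨z, hz⟩ := exists_testFunction_notMem hN (rangeAdjoint F)
  have hw1 : ∫ x, conj (w.1 x) * w.1 x ≠ 0 := by
    have h1 : ∫ x, conj (w.1 x) * w.1 x = ((∫ x, ‖w.1 x‖ ^ 2 : ℝ) : ℂ) := by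
      rw [← integral_complex_ofReal]
      congr 1
      funext x
      rw [Complex.conj_mul']
      push_cast
      rfl
    rw [h1, Ne, Complex.ofReal_eq_zero]
    intro h2
    have h3 : Continuous fun x => ‖w.1 x‖ ^ 2 := by fun_prop
    have h4 : HasCompactSupport fun x => ‖w.1 x‖ ^ 2 :=
      w.2.comp_left (g := fun c : ℂ => ‖c‖ ^ 2) (by simp)
    rw [integral_eq_zero_iff_of_nonneg (fun x => by positivity)
      (h3.integrable_of_hasCompactSupport h4)] at h2
    have h5 := Continuous.ae_eq_iff_eq volume h3 continuous_zero |>.1 h2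
    refine hw0 (Subtype.ext (DFunLike.ext _ _ fun x => ?_))
    simpa using congrFun h5 x
  obtain ⟨δ, hδ0, hδb⟩ := hδ hb
  -- The nudge is along w itself, since its pairing with w is ‖w‖² ≠ 0.
  obtain ⟨u, hu, hua⟩ := exists_schwartz_eLpNorm_sub_le ha hδ0 w.1
    (fun g => ∫ x, conj (g x) * w.1 x ≠ 0) fun g => by
      rw [or_iff_not_imp_left]
      intro hg t ht
      rw [not_not] at hg
      have hi : ∀ g : 𝓢(RN N, ℂ), Integrable fun x => conj (g x) * w.1 x := fun g =>
        (g.memLp 2 volume).conj_fun.integrable_mul (w.1.memLp 2 volume)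
      have h1 : ∫ x, conj ((g + t • w.1) x) * w.1 x = conj t * ∫ x, conj (w.1 x) * w.1 x := by
        simp only [add_apply, smul_apply, map_add, smul_eq_mul, map_mul, add_mul, mul_assoc]
        rw [integral_add (hi g) ((hi w.1).const_mul _), hg, zero_add, integral_const_mul]
      rw [h1]
      exact mul_ne_zero (by simpa using ht) hw1
  -- The tolerance for v depends on the u already chosen, through u⊗v - a⊗b = (u - a)⊗b + u⊗(v - b).
  obtain ⟨δ', hδ'0, hδ'u⟩ := hδ (u.memLp 2 volume)
  obtain ⟨v, hv, hvb⟩ := exists_schwartz_eLpNorm_sub_le hb hδ'0 z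
    (fun g => (fun y => conj (g y)) ∉ rangeAdjoint F) fun g => by
      rw [or_iff_not_imp_left]
      intro hg t ht h1
      rw [not_not] at hg
      have h2 : (fun y => conj ((g + t • z) y)) =
          (fun y => conj (g y)) + conj t • fun y => conj (z y) := by
        funext y
        simp
      rw [h2, Submodule.add_mem_iff_right _ hg,
        Submodule.smul_mem_iff _ (by simpa using ht)] at h1
      exact hz h1
  have hG : Continuous (Function.uncurry (F + tensor u v)) :=
    hF.add ((u.continuous.comp continuous_fst).mul (v.continuous.comp continuous_snd))
  refine ⟨u, v, rank_rangeAdjoint_add_tensor hF hd hw hu hv hG, ?_⟩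
  have h1 : Function.uncurry (tensor u v - tensor a b) =
      Function.uncurry (tensor (⇑u - a) b) + Function.uncurry (tensor u (⇑v - b)) := by
    funext p
    simp only [Function.uncurry_def, Pi.sub_apply, Pi.add_apply, tensor]
    ring
  have hum := u.memLp 2 volume
  have hvm := v.memLp 2 volume
  rw [h1, ← ENNReal.add_halves ε]
  refine (eLpNorm_add_le (memLp_tensor (hum.sub ha) hb).1 (memLp_tensor hum (hvm.sub hb)).1
    (by norm_num)).trans (add_le_add ?_ ?_)
  · rw [eLpNorm_tensor (hum.sub ha).1 hb.1]
    exact (mul_le_mul_left hua _).trans hδb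
  · rw [eLpNorm_tensor hum.1 (hvm.sub hb).1, mul_comm]
    exact (mul_le_mul_left hvb _).trans hδ'u

theorem exists_symbol_approx_rank_add (hN : 0 < N) {F : RN N → RN N → ℂ} (hF : IsSymbol F)
    {d : ℕ} (hd : Module.rank ℂ (rangeAdjoint F) = d) {a b : ℕ → RN N → ℂ}
    (ha : ∀ i, MemLp (a i) 2 volume) (hb : ∀ i, MemLp (b i) 2 volume) (k : ℕ) {ε : ℝ≥0∞}
    (hε : ε ≠ 0) :
    ∃ G : RN N → RN N → ℂ, IsSymbol G ∧ Module.rank ℂ (rangeAdjoint G) = (d + k : ℕ) ∧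
      MemLp (Function.uncurry (G - F)) 2 (volume.prod volume) ∧
      eLpNorm (Function.uncurry fun x y =>
        (G - F) x y - ∑ i ∈ Finset.range k, tensor (a i) (b i) x y) 2 (volume.prod volume) ≤ ε := by
  induction k generalizing ε with
  | zero =>
    refine ⟨F, hF, hd, ?_, ?_⟩
    · rw [sub_self]
      exact MemLp.zero
    · simp [Function.uncurry_def]
  | succ k ih =>
    obtain ⟨G, hG, hGr, hGF, hGε⟩ := ih (ε := ε / 2) (by simpa using hε)
    obtain ⟨u, v, huv, huvε⟩ := exists_tensor_approx_rank_succ hN hG.continuous hGr (ha k) (hb k)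
      (ε := ε / 2) (by simpa using hε)
    have huvm := memLp_tensor (u.memLp 2 volume) (v.memLp 2 volume)
    refine ⟨G + tensor u v, hG.add_tensor u v, huv, ?_, ?_⟩
    · rw [add_sub_right_comm]
      exact hGF.add huvm
    · have h1 : (Function.uncurry fun x y => (G + tensor u v - F) x y -
          ∑ i ∈ Finset.range (k + 1), tensor (a i) (b i) x y) =
          (Function.uncurry fun x y =>
            (G - F) x y - ∑ i ∈ Finset.range k, tensor (a i) (b i) x y) +
          Function.uncurry (tensor u v - tensor (a k) (b k)) := by
        funext p
        simp only [Function.uncurry_def, Pi.sub_apply, Pi.add_apply, Finset.sum_range_succ]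
        ring
      rw [h1, ← ENNReal.add_halves ε]
      exact (eLpNorm_add_le
        (hGF.sub (memLp_finsetSum _ fun i _ => memLp_tensor (ha i) (hb i))).1
        (huvm.sub (memLp_tensor (ha k) (hb k))).1 (by norm_num)).trans (add_le_add hGε huvε)

end Approximation

/-! ### From L² norms of kernels to Hilbert–Schmidt norms of F(D, x) -/

section HilbertSchmidtNorm

/-- Plancherel in this normalisation: the factor (2π)^N is the Jacobian of the dilation linking
`fourierCheck` to the unitary transform. -/
theorem integral_conj_fourierCheck_mul (f g : 𝓢(RN N, ℂ)) :
    ∫ x, conj (fourierCheck f x) * fourierCheck g x =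
      ((2 * Real.pi : ℝ) : ℂ) ^ N * ∫ x, conj (f x) * g x := by
  have h1 := (FourierTransform.fourierInv f : 𝓢(RN N, ℂ)).integral_inner_fourier_fourier
    (FourierTransform.fourierInv g)
  simp only [FourierTransform.fourier_fourierInv_eq] at h1
  have h2 : ∀ f g : 𝓢(RN N, ℂ), ∫ x, ⟪f x, g x⟫_ℂ = ∫ x, conj (f x) * g x := fun f g => by
    simp [mul_comm]
  simp only [h2] at h1
  rw [h1]
  have h3 := Measure.integral_comp_smul volume (fun x : RN N =>
    conj ((FourierTransformInv.fourierInv f : 𝓢(RN N, ℂ)) x) *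
      (FourierTransformInv.fourierInv g : 𝓢(RN N, ℂ)) x) (2 * Real.pi)⁻¹
  simp only [fourierCheck_eq]
  rw [h3, finrank_euclideanSpace_fin, inv_pow, inv_inv, abs_of_pos (by positivity),
    Complex.real_smul, Complex.ofReal_pow]

theorem enorm_exp_neg_I_mul (t : ℝ) : ‖Complex.exp (-(Complex.I * t))‖ₑ = 1 := by
  rw [← ofReal_norm, ← mul_neg, ← Complex.ofReal_neg, mul_comm, Complex.norm_exp_ofReal_mul_I,
    ENNReal.ofReal_one]

theorem pdoRight_sub {F G : RN N → RN N → ℂ} (hF : Continuous (Function.uncurry F))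
    (hG : Continuous (Function.uncurry G)) (f : 𝓢(RN N, ℂ))
    (hf : HasCompactSupport (fourierCheck f)) (y : RN N) :
    pdoRight F f y - pdoRight G f y = pdoRight (F - G) f y := by
  have h : ∀ {F : RN N → RN N → ℂ}, Continuous (Function.uncurry F) → Integrable fun x =>
      conj (F x y) * Complex.exp (-(Complex.I * ⟪x, y⟫_ℝ)) * fourierCheck f x := fun {F} hF => by
    refine Continuous.integrable_of_hasCompactSupport ?_ (HasCompactSupport.mul_left hf)
    have h1 : Continuous fun x => F x y := hF.comp (Continuous.prodMk_left y)
    have h2 := continuous_fourierCheck f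
    fun_prop
  simp only [pdoRight, ← mul_sub]
  rw [← integral_sub (h hF) (h hG)]
  congr 2
  funext x
  simp only [Pi.sub_apply, map_sub]
  ring

theorem hsNorm_pdoRight_sub_le {F G : RN N → RN N → ℂ} (hF : IsSymbol F) (hG : IsSymbol G)
    (hFG : MemLp (Function.uncurry (F - G)) 2 (volume.prod volume)) :
    hsNorm (fun f x => pdoRight F f x - pdoRight G f x) ≤
      eLpNorm (Function.uncurry (F - G)) 2 (volume.prod volume) := by
  set M : RN N → RN N → ℂ :=
    fun y x => conj ((F - G) x y) * Complex.exp (-(Complex.I * ⟪x, y⟫_ℝ)) with hM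
  have hMc : Continuous (Function.uncurry M) := by
    have h1 : Continuous fun p : RN N × RN N => F p.2 p.1 := hF.continuous.comp continuous_swap
    have h2 : Continuous fun p : RN N × RN N => G p.2 p.1 := hG.continuous.comp continuous_swap
    exact (RCLike.continuous_conj.comp (h1.sub h2)).mul (by fun_prop)
  have hMe : eLpNorm (Function.uncurry M) 2 (volume.prod volume) =
      eLpNorm (Function.uncurry (F - G)) 2 (volume.prod volume) := by
    rw [← eLpNorm_comp_measurePreserving hFG.1 Measure.measurePreserving_swap]
    refine eLpNorm_congr_enorm_ae (.of_forall fun p => ?_)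
    simp only [hM, Function.uncurry_def, enorm_mul, enorm_exp_neg_I_mul, mul_one, RCLike.enorm_conj,
      Function.comp_apply, Prod.fst_swap, Prod.snd_swap]
  have hMm : MemLp (Function.uncurry M) 2 (volume.prod volume) :=
    ⟨hMc.aestronglyMeasurable, hMe ▸ hFG.2⟩
  have hpi : (0 : ℝ) < 2 * Real.pi := Real.two_pi_pos
  -- r = (2π)^(N/2), so r⁻¹ 𝓕⁻¹ sends the orthonormal family f to an orthonormal family e, to which
  -- Bessel applies.
  set r : ℝ := Real.sqrt ((2 * Real.pi) ^ N) with hr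
  have hr0 : 0 < r := Real.sqrt_pos.2 (by positivity)
  have hr2 : r ^ 2 = (2 * Real.pi) ^ N := Real.sq_sqrt (by positivity)
  have hr1 : 1 ≤ r := by
    rw [hr, Real.one_le_sqrt]
    exact one_le_pow₀ (by linarith [Real.pi_gt_three])
  have hrc : (r : ℂ) ≠ 0 := by exact_mod_cast hr0.ne'
  have hr2c : (r : ℂ) ^ 2 = ((2 * Real.pi : ℝ) : ℂ) ^ N := by exact_mod_cast hr2
  rw [hsNorm, ← ENNReal.rpow_le_rpow_iff (z := 2) (by norm_num), ← ENNReal.rpow_mul]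
  norm_num only [ENNReal.rpow_one, ENNReal.rpow_ofNat]
  refine iSup_le fun k => iSup_le fun f => iSup_le fun hf => iSup_le fun hfo => ?_
  have hm : ∀ i, MemLp (fun x => (r : ℂ)⁻¹ * fourierCheck (f i) x) 2 volume := fun i =>
    ((continuous_fourierCheck (f i)).memLp_of_hasCompactSupport (hf i)).const_mul _
  let e : Fin k → Lp ℂ 2 (volume : Measure (RN N)) := fun i => (hm i).toLp
  have he : Orthonormal ℂ e := by
    rw [orthonormal_iff_ite]
    intro i j
    have h1 : ∀ x, conj ((r : ℂ)⁻¹ * fourierCheck (f i) x) * ((r : ℂ)⁻¹ * fourierCheck (f j) x) =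
        ((r : ℂ) ^ 2)⁻¹ * (conj (fourierCheck (f i) x) * fourierCheck (f j) x) := fun x => by
      rw [map_mul, map_inv₀, Complex.conj_ofReal]
      ring
    have h2 : ⟪e i, e j⟫_ℂ =
        ∫ x, conj ((r : ℂ)⁻¹ * fourierCheck (f i) x) * ((r : ℂ)⁻¹ * fourierCheck (f j) x) := by
      rw [← integral_conj_mul_eq_inner]
      refine integral_congr_ae ?_
      filter_upwards [(hm i).coeFn_toLp, (hm j).coeFn_toLp] with x hi hj
      rw [hi, hj]
    rw [h2]
    simp only [h1]
    rw [integral_const_mul, integral_conj_fourierCheck_mul, hfo, ← hr2c,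
      inv_mul_cancel_left₀ (pow_ne_zero 2 hrc)]
  have h3 : ∀ i y, ‖pdoRight F (f i) y - pdoRight G (f i) y‖ₑ ≤ ‖intOp volume M (e i) y‖ₑ := by
    intro i y
    -- The integral carries r⁻¹ on the left and (2π)^(-N) = r⁻² inside `pdoRight`, so one factor r ≥
    -- 1 remains and may be dropped.
    have h4 : intOp volume M (e i) y = (r : ℂ) * pdoRight (F - G) (f i) y := by
      have h5 : intOp volume M (e i) y = ∫ x, (r : ℂ)⁻¹ * (M y x * fourierCheck (f i) x) := by
        refine integral_congr_ae ?_
        filter_upwards [(hm i).coeFn_toLp] with x hx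
        rw [hx]
        ring
      rw [h5, integral_const_mul, pdoRight, zpow_neg, zpow_natCast, ← hr2c]
      simp only [hM]
      field_simp
    rw [h4, pdoRight_sub hF.continuous hG.continuous (f i) (hf i), enorm_mul]
    refine le_mul_of_one_le_left' ?_
    rw [← ofReal_norm, Complex.norm_real, Real.norm_of_nonneg hr0.le]
    simpa using hr1
  rw [← hMe]
  refine le_trans (Finset.sum_le_sum fun i _ => ?_) (sum_sq_eLpNorm_intOp_le hMm he)
  rw [sq_eLpNorm_two]
  exact lintegral_mono fun y => pow_le_pow_left' (h3 i y) 2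

end HilbertSchmidtNorm

end

/-! ### The bound for the approximation error -/

theorem mainTheorem10 (N : ℕ) (hN : 0 < N) :
    ∃ c : ℝ≥0, ∀ (κ : ℝ), 0 < κ → ∀ (K : RN N → RN N → ℝ) (F δF : RN N → RN N → ℂ) (d : ℕ),
      IsSymbol F → Module.rank ℂ (rangeAdjoint F) = d →
      MemSym κ K (F + δF) →
      ∀ (hδF : MemLp (Function.uncurry δF) 2 (volume.prod volume)) (σ : ℕ → ℝ),
        IsSingularValueSeq (intOpL2 δF hδF) σ →
        ∀ n : ℕ, d ≤ n →
          approxError κ K n ≤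
            c * (∑' i : ℕ, ENNReal.ofReal (σ (n - d + i) ^ 2)) ^ (1 / 2 : ℝ) := by
  refine ⟨1, fun κ _ K F δF d hF hd hK hδF σ hσ n hdn => ?_⟩
  rw [ENNReal.coe_one, one_mul]
  refine le_of_forall_pos_le_add fun ε hε => ?_
  obtain ⟨a, b, ha, hb, hab⟩ := exists_tensor_sum_approx hδF hσ (n - d)
  obtain ⟨G, hG, hGr, hGF, hGε⟩ := exists_symbol_approx_rank_add hN hF hd ha hb (n - d) hε.ne'
  rw [Nat.add_sub_cancel' hdn] at hGr
  have hsum : MemLp (∑ i ∈ Finset.range (n - d), Function.uncurry (tensor (a i) (b i))) 2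
      ((volume : Measure (RN N)).prod volume) :=
    memLp_finsetSum' _ fun i _ => memLp_tensor (ha i) (hb i)
  -- `F` and `G` need not be square-integrable separately; only `δF`, `G - F` and the tensors are.
  -- The first bracket is the Schmidt remainder, the second the ε-error.
  have h1 : Function.uncurry (F + δF - G) =
      (Function.uncurry δF - ∑ i ∈ Finset.range (n - d), Function.uncurry (tensor (a i) (b i))) -
      (Function.uncurry (G - F) -
        ∑ i ∈ Finset.range (n - d), Function.uncurry (tensor (a i) (b i))) := by
    funext p
    simp only [Function.uncurry_def, Pi.sub_apply, Pi.add_apply]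
    ring
  have h2 : MemLp (Function.uncurry (F + δF - G)) 2 (volume.prod volume) := by
    rw [h1]
    exact (hδF.sub hsum).sub (hGF.sub hsum)
  have h3 : ∀ H : RN N → RN N → ℂ, (Function.uncurry fun x y =>
      H x y - ∑ i ∈ Finset.range (n - d), tensor (a i) (b i) x y) =
      Function.uncurry H - ∑ i ∈ Finset.range (n - d), Function.uncurry (tensor (a i) (b i)) :=
    fun H => by
      funext p
      simp [Function.uncurry_def]
  rw [h3] at hab hGε
  have h4 : approxError κ K n ≤ hsNorm fun f x => pdoRight (F + δF) f x - pdoRight G f x := by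
    unfold approxError
    exact iInf_le_of_le (F + δF) <| iInf_le_of_le G <| iInf_le_of_le hK <| iInf_le_of_le hG <|
      iInf_le _ hGr
  refine h4.trans ((hsNorm_pdoRight_sub_le hK.1 hG h2).trans ?_)
  rw [h1]
  refine (eLpNorm_sub_le (hδF.sub hsum).1 (hGF.sub hsum).1 (by norm_num)).trans
    (add_le_add ?_ hGε)
  rw [← ENNReal.rpow_le_rpow_iff (z := 2) (by norm_num), ← ENNReal.rpow_mul]
  norm_num only [ENNReal.rpow_one, ENNReal.rpow_ofNat]
  exact hab
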